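/- **Setting.** Let $X_n$ be a finite-dimensional simple Lie algebra over $\mathbb C$ (of type $A_n$ ($n\ge1$), $B_n,C_n$ ($n\ge2$), $D_n$ ($n\ge4$), $E_6,E_7,E_8,F_4$ or $G_2$) with simple roots $\alpha_1,\dots,\alpha_n$, let $(\cdot|\cdot)$ be the invariant form with $(\alpha|\alpha)=2$ for long roots, and put $t_a=2/(\alpha_a|\alpha_a)$, $t=\max_a t_a$, $C_{ab}=t_a(\alpha_a|\alpha_b)$. Let $H=\{1,\dots,n\}\times\mathbb Z_{\ge1}$, and let $\mathcal N$ be the set of finitely supported families $(N_m^{(a)})_{(a,m)\in H}$ of non-negative integers. Fix $\nu\in\mathcal N$ (quantum space data) and $N\in\mathcal N$ (string pattern), and put $H'=\{(a,m)\in H: N_m^{(a)}>0\}$ and $$P_m^{(a)}=\sum_{k\ge1}\min(m,k)\nu_k^{(a)}-\sum_{(b,k)\in H}(\alpha_a|\alpha_b)\min(t_bm,t_ak)N_k^{(b)} .$$ Indices $(a,m,\alpha)$ run over $(a,m)\in H'$, $1\le\alpha\le N_m^{(a)}$, and indices $(a,m,\alpha,i)$ moreover over $1\le i\le m$. **Bethe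 equation.** For functions $x_{m\alpha i}^{(a)}(q)$ meromorphic around $q=0$ (functions that agree near $q=0$ are identified) it reads $F_{m\alpha i+}^{(a)}G_{m\alpha i-}^{(a)}=-F_{m\alpha i-}^{(a)}G_{m\alpha i+}^{(a)}$ for all $(a,m,\alpha,i)$, where, with $x=x_{m\alpha i}^{(a)}$, $$F_{m\alpha i+}^{(a)}=\prod_{k\ge1}(xq^{kt/t_a}-1)^{\nu_k^{(a)}},\qquad F_{m\alpha i-}^{(a)}=\prod_{k\ge1}(x-q^{kt/t_a})^{\nu_k^{(a)}},$$ $$G_{m\alpha i+}^{(a)}=\prod_{b,k,\beta,j}\bigl(xq^{(\alpha_a|\alpha_b)t}-x_{k\beta j}^{(b)}\bigr),\qquad G_{m\alpha i-}^{(a)}=\prod_{b,k,\beta,j}\bigl(x-x_{k\beta j}^{(b)}q^{(\alpha_a|\alpha_b)t}\bigr).$$ **String solutions.** Let $\mathrm{ord}$ be the order at $q=0$. A *string solution of pattern $N$* is a solution such that $\mathrm{ord}(F_{m\alpha i+}^{(a)}G_{m\alpha i-}^{(a)})<\infty$ and $\mathrm{ord}(x_{m\alpha i}^{(a)})=d_{m\alpha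 i}^{(a)}:=(m+1-2i)t/t_a$ for all $(a,m,\alpha,i)$, and such that the leading coefficient of $x_{m\alpha i}^{(a)}$ does not depend on $i$; this coefficient is the *string center* $z_{m\alpha}^{(a)}$. Put $\tilde x_{m\alpha i}^{(a)}=q^{-d_{m\alpha i}^{(a)}}x_{m\alpha i}^{(a)}$, $\zeta_{m\alpha i}^{(a)}=\mathrm{ord}(\tilde x_{m\alpha i}^{(a)}-\tilde x_{m\alpha\,i-1}^{(a)})$ for $2\le i\le m$, and $\zeta_{m\alpha1}^{(a)}=\zeta_{m\alpha\,m+1}^{(a)}=0$. A string solution is *generic* if for all $(a,m,\alpha,i)$ $$\mathrm{ord}F_{m\alpha i+}^{(a)}=\tfrac t{t_a}\sum_k\nu_k^{(a)}\min(m+1-2i+k,0),\qquad \mathrm{ord}F_{m\alpha i-}^{(a)}=\tfrac t{t_a}\sum_k\nu_k^{(a)}\min(m+1-2i,k),$$ $$\mathrm{ord}G_{m\alpha i+}^{(a)}=\zeta_{m\alpha i}^{(a)}+\sum_{b,k,\beta,j}\min\bigl(d_{m\alpha i}^{(a)}+(\alpha_a|\alpha_b)t,\ d_{k\beta j}^{(b)}\bigr),$$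 $$\mathrm{ord}G_{m\alpha i-}^{(a)}=\zeta_{m\alpha\,i+1}^{(a)}+\sum_{b,k,\beta,j}\min\bigl(d_{m\alpha i}^{(a)},\ d_{k\beta j}^{(b)}+(\alpha_a|\alpha_b)t\bigr).$$ **String center equation (SCE).** For non-zero complex numbers $z_{m\alpha}^{(a)}$ it reads, for all $(a,m,\alpha)$, $$\prod_{b,k,\beta}(z_{k\beta}^{(b)})^{A_{am\alpha,bk\beta}}=(-1)^{P_m^{(a)}+N_m^{(a)}+1},$$ $$A_{am\alpha,bk\beta}=\delta_{ab}\delta_{mk}\delta_{\alpha\beta}(P_m^{(a)}+N_m^{(a)})+(\alpha_a|\alpha_b)\min(t_bm,t_ak)-\delta_{ab}\delta_{mk}.$$ A solution of the SCE is *generic* if for every $(a,m,\alpha)$: (i) $z_{m\alpha}^{(a)}\ne1$ whenever $\nu_k^{(a)}>0$ for some $1\le k<m$ with $k\not\equiv m \pmod 2$; (ii) $z_{m\alpha}^{(a)}\ne z_{k\beta}^{(b)}$ for every $(b,k,\beta)\ne(a,m,\alpha)$ for which there are $1\le i\le m$ and $1\le j\le k$ with $t_b(m+1-2i)+t_at_b(\alpha_a|\alpha_b)=t_a(k+1-2j)$.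 **Order conditions.** For all $(a,m)\in H'$ and $2\le i\le m$, $$\sum_{k=1}^{\min(i-1,m+1-i)}\Bigl\{\tfrac t{t_a}\bigl(P_{m+1-2k}^{(a)}+N_{m+1-2k}^{(a)}\bigr)+\Delta_{m+1-2k}^{(a)}\Bigr\}>0,$$ where $\Delta_j^{(a)}=0$ unless $t_a=1$ and there is $a'$ with $t_{a'}\ne1$, $C_{aa'}\neq0$, in which case $\Delta_j^{(a)}=-N_{2j}^{(a')}$ if $t_{a'}=2$ and $\Delta_j^{(a)}=-(N_{3j-1}^{(a')}+2N_{3j}^{(a')}+N_{3j+1}^{(a')})$ if $t_{a'}=3$. **Theorem.** Suppose that $N$ satisfies the order conditions and that $\det A\ne0$. Then sending a solution to its string centers is a bijection from the set of generic string solutions of pattern $N$ to the $U_q(X_n^{(1)})$ Bethe equation onto the set of generic solutions of the SCE of pattern $N$. -/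

import Mathlib

open Filter Topology

noncomputable section

namespace StringBethe

/-- The types `X_n` of finite-dimensional simple Lie algebras over `ℂ`. -/
inductive CartanType : Type
  | A (n : ℕ) (hn : 1 ≤ n)
  | B (n : ℕ) (hn : 2 ≤ n)
  | C (n : ℕ) (hn : 2 ≤ n)
  | D (n : ℕ) (hn : 4 ≤ n)
  | E6
  | E7
  | E8
  | F4
  | G2

namespace CartanType

/-- The rank `n` of `X_n`. -/
def rank : CartanType → ℕ
  | A n _ => n
  | B n _ => n
  | C n _ => n
  | D n _ => n
  | E6 => 6
  | E7 => 7
  | E8 => 8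
  | F4 => 4
  | G2 => 2

/-- The edges of the Dynkin diagram, whose vertices carry the labels `1, …, n`; each edge is listed
once, from the smaller label to the larger one, and multiplicities are forgotten.
The diagram is a chain `1 - 2 - ⋯ - n`, except in types `D` and `E`, where it is a chain
`1 - 2 - ⋯ - (n-1)` with the vertex `n` attached to `n-2` (type `D_n`), `3` (types `E_6`, `E_7`),
`5` (type `E_8`). -/
def edge : CartanType → ℕ → ℕ → Prop
  | A _ _, i, j => i + 1 = j
  | B _ _, i, j => i + 1 = j
  | C _ _, i, j => i + 1 = j
  | D n _, i, j => (i + 1 = j ∧ j < n) ∨ (i + 2 = n ∧ j = n)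
  | E6, i, j => (i + 1 = j ∧ j < 6) ∨ (i = 3 ∧ j = 6)
  | E7, i, j => (i + 1 = j ∧ j < 7) ∨ (i = 3 ∧ j = 7)
  | E8, i, j => (i + 1 = j ∧ j < 8) ∨ (i = 5 ∧ j = 8)
  | F4, i, j => i + 1 = j
  | G2, i, j => i + 1 = j

instance (X : CartanType) (i j : ℕ) : Decidable (X.edge i j) := by
  cases X <;> unfold edge <;> infer_instance

/-- `t_a = 2 / (α_a | α_a)` for the simple root with label `i`, long roots having square length 2:
`t_a = 1` for long roots, and `t_a = 2` (types `B`, `C`, `F`) or `3` (type `G`) for short roots. -/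
def tLabel : CartanType → ℕ → ℕ
  | B n _, i => if i = n then 2 else 1
  | C n _, i => if i = n then 1 else 2
  | F4, i => if i ≤ 2 then 1 else 2
  | G2, i => if i = 1 then 1 else 3
  | _, _ => 1

variable (X : CartanType)

/-- The index set of the simple roots; `a : X.Color` has the label `a + 1`. -/
abbrev Color : Type := Fin X.rank

/-- `t_a = 2 / (α_a | α_a)`. -/
def t (a : X.Color) : ℕ := X.tLabel (a + 1)

/-- Adjacency in the Dynkin diagram. -/
def Adj (a b : X.Color) : Prop := X.edge (a + 1) (b + 1) ∨ X.edge (b + 1) (a + 1)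

instance (a b : X.Color) : Decidable (X.Adj a b) := by
  unfold Adj; infer_instance

/-- The Cartan matrix `C_{ab} = t_a (α_a | α_b) = 2 (α_a | α_b) / (α_a | α_a)`. For adjacent `a ≠ b`
it is `-1` if `α_a` is not shorter than `α_b`, and minus the ratio of the square lengths, which is
`t_a`, if `α_a` is shorter than `α_b`. -/
def cartan (a b : X.Color) : ℤ :=
  if a = b then 2
  else if X.Adj a b then (if X.t a ≤ X.t b then -1 else -(X.t a : ℤ))
  else 0

/-- The standard bilinear form `(α_a | α_b) = C_{ab} / t_a`. -/
def form (a b : X.Color) : ℚ := (X.cartan a b : ℚ) / (X.t a : ℚ)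

/-- `t = max_a t_a`. -/
def tmax : ℕ := Finset.univ.sup X.t

/-- The integer `t / t_a` (the division is exact, see `cast_tquot`). -/
def tquot (a : X.Color) : ℕ := X.tmax / X.t a

/-- The integer `t (α_a | α_b)` (see `cast_formT`). -/
def formT (a b : X.Color) : ℤ := (X.tquot a : ℤ) * X.cartan a b

/-- The integer `(α_a | α_b) min (t_b m, t_a k) = C_{ab} min (t_b m, t_a k) / t_a` (the division is
exact, see `cast_formMin`). -/
def formMin (a : X.Color) (m : ℕ) (b : X.Color) (k : ℕ) : ℤ :=
  X.cartan a b * ((min (X.t b * m) (X.t a * k) : ℕ) : ℤ) / (X.t a : ℤ)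

lemma t_cases : ∃ c : ℕ, 1 ≤ c ∧ ∀ a : X.Color, X.t a = 1 ∨ X.t a = c := by
  cases X
  case G2 => exact ⟨3, by norm_num, fun a => by simp only [t, tLabel]; split_ifs <;> simp⟩
  all_goals exact ⟨2, by norm_num, fun a => by simp only [t, tLabel]; (try split_ifs) <;> simp⟩

lemma t_pos (a : X.Color) : 0 < X.t a := by
  obtain ⟨c, hc, h⟩ := X.t_cases
  rcases h a with h | h <;> omega

lemma t_dvd_tmax (a : X.Color) : X.t a ∣ X.tmax := by
  obtain ⟨c, hc, h⟩ := X.t_cases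
  rcases h a with h1 | h1
  · simp [h1]
  · have hle : X.tmax ≤ X.t a := Finset.sup_le fun b _ => by
      rcases h b with h2 | h2 <;> omega
    have hge : X.t a ≤ X.tmax := Finset.le_sup (f := X.t) (Finset.mem_univ a)
    rw [le_antisymm hge hle]

lemma adj_comm (a b : X.Color) : X.Adj a b ↔ X.Adj b a := by
  unfold Adj; exact or_comm

lemma t_mul_cartan (a b : X.Color) :
    (X.t b : ℤ) * X.cartan a b = (X.t a : ℤ) * X.cartan b a := by
  obtain ⟨c, hc, h⟩ := X.t_cases
  unfold cartan
  by_cases hab : a = b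
  · subst hab; rfl
  · rw [if_neg hab, if_neg (Ne.symm hab)]
    by_cases hadj : X.Adj a b
    · rw [if_pos hadj, if_pos ((X.adj_comm a b).1 hadj)]
      rcases lt_trichotomy (X.t a) (X.t b) with hlt | heq | hlt
      · have : X.t a = 1 := by rcases h a with h1 | h1 <;> rcases h b with h2 | h2 <;> omega
        rw [if_pos hlt.le, if_neg (not_le.2 hlt), this]; push_cast; ring
      · rw [if_pos heq.le, if_pos heq.ge, heq]
      · have : X.t b = 1 := by rcases h a with h1 | h1 <;> rcases h b with h2 | h2 <;> omega
        rw [if_neg (not_le.2 hlt), if_pos hlt.le, this]; push_cast; ring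
    · rw [if_neg hadj, if_neg (fun h' => hadj ((X.adj_comm a b).2 h'))]; simp

lemma cast_tquot (a : X.Color) : (X.tquot a : ℚ) = (X.tmax : ℚ) / (X.t a : ℚ) := by
  unfold tquot
  rw [Nat.cast_div (X.t_dvd_tmax a) (by exact_mod_cast (X.t_pos a).ne')]

lemma form_comm (a b : X.Color) : X.form a b = X.form b a := by
  have ha : (X.t a : ℚ) ≠ 0 := by exact_mod_cast (X.t_pos a).ne'
  have hb : (X.t b : ℚ) ≠ 0 := by exact_mod_cast (X.t_pos b).ne'
  have h : (X.t b : ℚ) * X.cartan a b = (X.t a : ℚ) * X.cartan b a := by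
    exact_mod_cast X.t_mul_cartan a b
  unfold form
  rw [div_eq_div_iff ha hb]
  linarith

lemma cast_formT (a b : X.Color) : (X.formT a b : ℚ) = (X.tmax : ℚ) * X.form a b := by
  unfold formT form
  push_cast
  rw [X.cast_tquot a]
  ring

lemma cast_formMin (a : X.Color) (m : ℕ) (b : X.Color) (k : ℕ) :
    (X.formMin a m b k : ℚ) =
      X.form a b * min ((X.t b : ℚ) * m) ((X.t a : ℚ) * k) := by
  have ha : (X.t a : ℚ) ≠ 0 := by exact_mod_cast (X.t_pos a).ne'
  have hdvd : (X.t a : ℤ) ∣ X.cartan a b * ((min (X.t b * m) (X.t a * k) : ℕ) : ℤ) := by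
    rcases min_choice (X.t b * m) (X.t a * k) with h | h <;> rw [h]
    · refine ⟨X.cartan b a * m, ?_⟩
      push_cast
      linear_combination (m : ℤ) * X.t_mul_cartan a b
    · refine ⟨X.cartan a b * k, ?_⟩
      push_cast
      ring
  unfold formMin form
  rw [Int.cast_div hdvd (by exact_mod_cast ha)]
  push_cast
  ring

/-- `H = {(a, m) | 1 ≤ a ≤ n, m ≥ 1}`. -/
abbrev H : Type := X.Color × ℕ+

/-- The set `𝒩` of finitely supported families `(N_m^{(a)})` of non-negative integers; both the
quantum space data and the string patterns are elements of it. -/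
abbrev Pattern : Type := X.H →₀ ℕ

end CartanType

variable {X : CartanType}

/-! ### The Bethe equation -/

section Bethe

variable {ι : Type} [Fintype ι] (ν : X.Pattern) (c : ι → X.Color) (x : ι → ℂ → ℂ)

/-- The factor `F_{i+}`, as a function of `q`. The unknowns `x_i^{(a)}` are indexed by a finite
type `ι` with a colouring `c`, so that `M_a` is the number of indices of colour `a`. -/
def Fplus (i : ι) (q : ℂ) : ℂ :=
  ∏ p ∈ ν.support with p.1 = c i, (x i q * q ^ ((p.2 : ℕ) * X.tquot (c i)) - 1) ^ ν p

/-- The factor `F_{i-}`. -/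
def Fminus (i : ι) (q : ℂ) : ℂ :=
  ∏ p ∈ ν.support with p.1 = c i, (x i q - q ^ ((p.2 : ℕ) * X.tquot (c i))) ^ ν p

/-- The factor `G_{i+}`. -/
def Gplus (i : ι) (q : ℂ) : ℂ :=
  ∏ j : ι, (x i q * q ^ X.formT (c i) (c j) - x j q)

/-- The factor `G_{i-}`. -/
def Gminus (i : ι) (q : ℂ) : ℂ :=
  ∏ j : ι, (x i q - x j q * q ^ X.formT (c i) (c j))

/-- `(x_i)` is a solution, meromorphic around `q = 0`, of the `U_q(X_n^{(1)})` Bethe equation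
`F_{i+} G_{i-} = - F_{i-} G_{i+}`. -/
def IsBetheSolution : Prop :=
  (∀ i, MeromorphicAt (x i) 0) ∧
  ∀ i, ∀ᶠ q in 𝓝[≠] (0 : ℂ),
    Fplus ν c x i q * Gminus c x i q = -(Fminus ν c x i q * Gplus c x i q)

/-- No factor `F_{i+} G_{i-}` vanishes identically. -/
def IsAdmissible : Prop :=
  ∀ i, meromorphicOrderAt (fun q => Fplus ν c x i q * Gminus c x i q) 0 < ⊤

end Bethe

/-! ### Strings -/

/-- The indices `(a, m, α)` of the strings of a pattern: `(a, m) ∈ H'(N)`, i.e. `N_m^{(a)} > 0`,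
and `1 ≤ α ≤ N_m^{(a)}`. -/
abbrev Str (N : X.Pattern) : Type := Σ p : {p : X.H // p ∈ N.support}, Fin (N p.1)

/-- The colour `a` of a string. -/
def Str.color {N : X.Pattern} (s : Str N) : X.Color := s.1.1.1

/-- The length `m` of a string. -/
def Str.len {N : X.Pattern} (s : Str N) : ℕ := (s.1.1.2 : ℕ)

lemma Str.len_pos {N : X.Pattern} (s : Str N) : 0 < s.len := s.1.1.2.pos

/-- The indices `(a, m, α, i)` with `1 ≤ i ≤ m`. The element `i : Fin m` stands for the position
`i + 1`. There are `M_a = ∑ m N_m^{(a)}` indices of colour `a`. -/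
abbrev Root (N : X.Pattern) : Type := Σ s : Str N, Fin s.len

/-- The colour of a member of a string. -/
def Root.color {N : X.Pattern} (v : Root N) : X.Color := v.1.color

/-- `m + 1 - 2 i` for the member at the position `i` of an `m`-string. -/
def Root.offset {N : X.Pattern} (v : Root N) : ℤ := (v.1.len : ℤ) + 1 - 2 * ((v.2 : ℕ) + 1 : ℤ)

/-- `d_{mαi}^{(a)} = (m + 1 - 2 i) t / t_a`. -/
def Root.d {N : X.Pattern} (v : Root N) : ℤ := v.offset * (X.tquot v.color : ℤ)

/-- The first member of a string. -/
def Str.first {N : X.Pattern} (s : Str N) : Root N := ⟨s, ⟨0, s.len_pos⟩⟩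

/-- `x = (x_{mαi}^{(a)})` is a string solution of pattern `N`: an admissible meromorphic solution
such that `x_{mαi}^{(a)}` has order `d_{mαi}^{(a)}` and the leading coefficient depends only on the
string. -/
structure IsStringSolution (ν N : X.Pattern) (x : Root N → ℂ → ℂ) : Prop where
  solution : IsBetheSolution ν Root.color x
  admissible : IsAdmissible ν Root.color x
  order : ∀ v, meromorphicOrderAt (x v) 0 = (v.d : WithTop ℤ)
  leading : ∀ (s : Str N) (i j : Fin s.len),
    meromorphicTrailingCoeffAt (x ⟨s, i⟩) 0 = meromorphicTrailingCoeffAt (x ⟨s, j⟩) 0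

/-- The normalized series `x̃ = q^{-d} x`. -/
def normalized {N : X.Pattern} (x : Root N → ℂ → ℂ) (v : Root N) (q : ℂ) : ℂ :=
  q ^ (-v.d) * x v q

/-- `ζ_{mαi} = ord (x̃_{mαi} - x̃_{mα,i-1})` for `2 ≤ i ≤ m`, and `ζ_{mα1} = ζ_{mα,m+1} = 0`. Here `i`
is the position itself, counted from `1`. -/
def zeta {N : X.Pattern} (x : Root N → ℂ → ℂ) (s : Str N) (i : ℕ) : WithTop ℤ :=
  if h : 2 ≤ i ∧ i ≤ s.len then
    meromorphicOrderAt (fun q => normalized x ⟨s, ⟨i - 1, by omega⟩⟩ q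
      - normalized x ⟨s, ⟨i - 2, by omega⟩⟩ q) 0
  else 0

/-- The superficial order `ξ_{mαi+}` of `F_{mαi+}`. -/
def xiPlus (ν : X.Pattern) {N : X.Pattern} (v : Root N) : ℤ :=
  (X.tquot v.color : ℤ) *
    ∑ p ∈ ν.support with p.1 = v.color, (ν p : ℤ) * min (v.offset + ((p.2 : ℕ) : ℤ)) 0

/-- The superficial order `ξ_{mαi-}` of `F_{mαi-}`. -/
def xiMinus (ν : X.Pattern) {N : X.Pattern} (v : Root N) : ℤ :=
  (X.tquot v.color : ℤ) *
    ∑ p ∈ ν.support with p.1 = v.color, (ν p : ℤ) * min v.offset ((p.2 : ℕ) : ℤ)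

/-- The superficial order `η_{mαi+}` of `G_{mαi+}`; each summand is
`t / (t_a t_b) * min (t_b (m + 1 - 2 i) + t_a t_b (α_a | α_b), t_a (k + 1 - 2 j))`. -/
def etaPlus {N : X.Pattern} (v : Root N) : ℤ :=
  ∑ w : Root N, min (v.d + X.formT v.color w.color) w.d

/-- The superficial order `η_{mαi-}` of `G_{mαi-}`; each summand is
`t / (t_a t_b) * min (t_b (m + 1 - 2 i), t_a (k + 1 - 2 j) + t_a t_b (α_a | α_b))`. -/
def etaMinus {N : X.Pattern} (v : Root N) : ℤ :=
  ∑ w : Root N, min v.d (w.d + X.formT v.color w.color)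

/-- A string solution is generic if the factors `F` and `G` have the superficial orders, up to the
contribution `ζ` of the neighbours in the same string. -/
structure IsGenericStringSolution (ν N : X.Pattern) (x : Root N → ℂ → ℂ) : Prop
    extends IsStringSolution ν N x where
  ord_Fplus : ∀ v : Root N,
    meromorphicOrderAt (Fplus ν Root.color x v) 0 = (xiPlus ν v : WithTop ℤ)
  ord_Fminus : ∀ v : Root N,
    meromorphicOrderAt (Fminus ν Root.color x v) 0 = (xiMinus ν v : WithTop ℤ)
  ord_Gplus : ∀ v : Root N,
    meromorphicOrderAt (Gplus Root.color x v) 0 =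
      (etaPlus v : WithTop ℤ) + zeta x v.1 ((v.2 : ℕ) + 1)
  ord_Gminus : ∀ v : Root N,
    meromorphicOrderAt (Gminus Root.color x v) 0 =
      (etaMinus v : WithTop ℤ) + zeta x v.1 ((v.2 : ℕ) + 2)

/-! ### The string center equation -/

/-- `γ_m^{(a)} = ∑_k min (m, k) ν_k^{(a)}`. -/
def gamma (ν : X.Pattern) (a : X.Color) (m : ℕ) : ℤ :=
  ∑ p ∈ ν.support with p.1 = a, ((min m (p.2 : ℕ) : ℕ) : ℤ) * (ν p : ℤ)

/-- `P_m^{(a)} = γ_m^{(a)} - ∑_{(b, k)} (α_a | α_b) min (t_b m, t_a k) N_k^{(b)}`. -/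
def vacancy (ν N : X.Pattern) (a : X.Color) (m : ℕ) : ℤ :=
  gamma ν a m - ∑ p ∈ N.support, X.formMin a m p.1 (p.2 : ℕ) * (N p : ℤ)

/-- `N_j^{(a)}` for a natural number `j`, with the value `0` at `j = 0`. -/
def count (N : X.Pattern) (a : X.Color) (j : ℕ) : ℤ :=
  if h : 0 < j then (N (a, ⟨j, h⟩) : ℤ) else 0

/-- The correction `Δ_j^{(a)}`. It is zero unless `t_a = 1` and there is a (then unique) `a'` with
`t_{a'} ≠ 1` and `C_{a a'} ≠ 0`. -/
def Delta (N : X.Pattern) (a : X.Color) (j : ℕ) : ℤ :=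
  ∑ b : X.Color with X.t a = 1 ∧ X.t b ≠ 1 ∧ X.cartan a b ≠ 0,
    if X.t b = 2 then -count N b (2 * j)
    else -(count N b (3 * j - 1) + 2 * count N b (3 * j) + count N b (3 * j + 1))

/-- The order conditions on a string pattern: for all `(a, m) ∈ H'` and `2 ≤ i ≤ m`,
`∑_{k=1}^{min (i-1, m+1-i)} ((t / t_a) (P_{m+1-2k} + N_{m+1-2k}) + Δ_{m+1-2k}) > 0`. -/
def OrderCondition (ν N : X.Pattern) : Prop :=
  ∀ p ∈ N.support, ∀ i : ℕ, 2 ≤ i → i ≤ (p.2 : ℕ) →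
    0 < ∑ k ∈ Finset.Icc 1 (min (i - 1) ((p.2 : ℕ) + 1 - i)),
      ((X.tquot p.1 : ℤ) * (vacancy ν N p.1 ((p.2 : ℕ) + 1 - 2 * k)
          + count N p.1 ((p.2 : ℕ) + 1 - 2 * k))
        + Delta N p.1 ((p.2 : ℕ) + 1 - 2 * k))

/-- The matrix `A`, with entries
`δ_{ab} δ_{mk} δ_{αβ} (P_m^{(a)} + N_m^{(a)}) + (α_a | α_b) min (t_b m, t_a k) - δ_{ab} δ_{mk}`. -/
def matA (ν N : X.Pattern) : Matrix (Str N) (Str N) ℤ :=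
  Matrix.of fun s s' =>
    (if s = s' then vacancy ν N s.color s.len + (N s.1.1 : ℤ) else 0)
      + X.formMin s.color s.len s'.color s'.len
      - (if s.1 = s'.1 then 1 else 0)

/-- The string center equation, for non-zero complex numbers `z_{mα}^{(a)}`. -/
def IsSCESolution (ν N : X.Pattern) (z : Str N → ℂ) : Prop :=
  (∀ s, z s ≠ 0) ∧
  ∀ s, ∏ s' : Str N, z s' ^ matA ν N s s' =
    (-1 : ℂ) ^ (vacancy ν N s.color s.len + (N s.1.1 : ℤ) + 1)

/-- The number of pairs `(i, j)`, `1 ≤ i ≤ m`, `1 ≤ j ≤ k`, for which the two terms of the factor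
`x_{mαi}^{(a)} q^{t (α_a | α_b)} - x_{kβj}^{(b)}` have the same order, i.e.
`t_b (m + 1 - 2 i) + t_a t_b (α_a | α_b) = t_a (k + 1 - 2 j)`. For two distinct strings this is the
exponent of `z_{mα}^{(a)} - z_{kβ}^{(b)}` in the product of the leading coefficients of these
factors. Because of the symmetry `(i, j) ↦ (m + 1 - i, k + 1 - j)` the factors
`x_{mαi}^{(a)} - x_{kβj}^{(b)} q^{t (α_a | α_b)}` give the same number. -/
def coincidence {N : X.Pattern} (s s' : Str N) : ℕ :=
  Fintype.card {ij : Fin s.len × Fin s'.len //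
    Root.d (⟨s, ij.1⟩ : Root N) + X.formT s.color s'.color = Root.d (⟨s', ij.2⟩ : Root N)}

/-- Generic solutions of the string center equation. -/
structure IsGenericSCESolution (ν N : X.Pattern) (z : Str N → ℂ) : Prop where
  solution : IsSCESolution ν N z
  ne_one : ∀ s : Str N,
    ∏ p ∈ ν.support with p.1 = s.color ∧ (p.2 : ℕ) < s.len ∧ ¬ (p.2 : ℕ) ≡ s.len [MOD 2],
      (z s - 1) ^ ν p ≠ 0
  ne : ∀ s : Str N, ∏ s' : Str N with s' ≠ s, (z s - z s') ^ coincidence s s' ≠ 0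

/-! ### Germs of meromorphic functions at `q = 0` -/

/-- Germs of functions on punctured neighbourhoods of `q = 0`. -/
abbrev QGerm : Type := Germ (𝓝[≠] (0 : ℂ)) ℂ

/-- The leading coefficient of the Laurent expansion of a germ at `q = 0`. -/
def leadingCoeff (g : QGerm) : ℂ :=
  g.liftOn (fun f => meromorphicTrailingCoeffAt f 0)
    (fun _ _ h => meromorphicTrailingCoeffAt_congr_nhdsNE h)

/-- The generic string solutions of pattern `N`. Two families of meromorphic functions that agree on
a punctured neighbourhood of `q = 0` are the same solution. -/
def genericStringSolutions (ν N : X.Pattern) : Set (Root N → QGerm) :=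
  {g | ∃ x : Root N → ℂ → ℂ, IsGenericStringSolution ν N x ∧ ∀ v, g v = (x v : QGerm)}

/-- The string centers of a family of germs. -/
def stringCenters (N : X.Pattern) (g : Root N → QGerm) (s : Str N) : ℂ := leadingCoeff (g s.first)

/-- The generic solutions of the string center equation. -/
def genericSCESolutions (ν N : X.Pattern) : Set (Str N → ℂ) :=
  {z | IsGenericSCESolution ν N z}

end StringBethe

end

open Filter Topology

noncomputable section

namespace StringBethe

/-! A generic string solution is encoded by analytic coordinates `u`: for each string its first
normalized member, and for each further member the difference from its predecessor divided by `q ^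
ζ`. The exponents are forced: comparing orders on the two sides of the Bethe equation gives ζ at the
next link minus ζ at the present one, the `slope`. The slope is an odd function of the offset and,
at positive offsets, is the summand of the order conditions (`slope_natCast`). So ζ returns to 0 at
the end of the string and is positive at every inner link (`zetaOrd_len`, `zetaOrd_pos`). At `q = 0`
each string therefore collapses to its center, and each order requirement becomes the nonvanishing
of a leading coefficient.

In these coordinates both sides of the Bethe equation carry the same power of `q`
(`IsCoordinates.bethe_iff`). Removing it leaves an analytic system `residual (q, u) = 0`, which at
`q = 0` reads `coefPlus * (next link) = -(coefMinus * (previous link))`. Multiplying along a string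
cancels the links; reflecting the string compares the two products of coefficients and turns the
result into the string center equation (`prod_coefPlus`). Conversely, a generic solution of that
equation determines the links recursively, the equation being the condition that the last link is 1.
Hence initial points correspond exactly to generic SCE solutions.

It remains to continue an initial point uniquely to `q ≠ 0`. Logarithmic differentiation of the same
product identity shows that a kernel vector of the Jacobian has center part `w` with `A (w / z) =
0`; since `det A ≠ 0` this part vanishes, and then so do the link parts, along each string
(`IsInitialPoint.tangent_eq_zero`). The implicit function theorem gives existence and uniqueness of
the germ `u`. -/

/-! ### Sums over the offsets of a string -/

/-- The sum of `φ` over the offsets `k - 1, k - 3, …, 1 - k` of a `k`-string. -/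
def offsetSum (k : ℕ) (φ : ℤ → ℤ) : ℤ := ∑ j ∈ Finset.range k, φ ((k : ℤ) - 1 - 2 * (j : ℤ))

@[simp] lemma offsetSum_zero (φ : ℤ → ℤ) : offsetSum 0 φ = 0 := rfl

@[simp] lemma offsetSum_one (φ : ℤ → ℤ) : offsetSum 1 φ = φ 0 := by simp [offsetSum]

/-- Lengthening a string by two keeps its offsets and adds an outer pair. This drives the two-step
inductions below, whose steps are piecewise linear identities within reach of `omega`. -/
lemma offsetSum_add_two (k : ℕ) (φ : ℤ → ℤ) :
    offsetSum (k + 2) φ = φ (k + 1) + offsetSum k φ + φ (-(k + 1)) := by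
  unfold offsetSum
  rw [Finset.sum_range_succ, Finset.sum_range_succ']
  push_cast
  have h : ∀ j : ℕ, (k : ℤ) + 2 - 1 - 2 * (j + 1) = k - 1 - 2 * j := fun j => by ring
  simp only [h]
  ring_nf

lemma offsetSum_congr {k : ℕ} {φ ψ : ℤ → ℤ} (h : ∀ o, φ o = ψ o) :
    offsetSum k φ = offsetSum k ψ := by
  rw [funext h]

lemma offsetSum_const_mul (k : ℕ) (c : ℤ) (φ : ℤ → ℤ) :
    offsetSum k (fun o => c * φ o) = c * offsetSum k φ := by
  simp [offsetSum, Finset.mul_sum]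

/-- The sign of an integer, as an expression accessible to linear arithmetic. -/
lemma sign_eq_ite (e : ℤ) : Int.sign e = (if 0 < e then 1 else 0) - (if e < 0 then 1 else 0) := by
  rcases lt_trichotomy e 0 with h | h | h
  · rw [Int.sign_eq_neg_one_of_neg h]; simp [h, h.not_gt]
  · simp [h]
  · rw [Int.sign_eq_one_of_pos h]; simp [h, h.not_gt]

lemma offsetSum_sign_add (m k : ℕ) :
    offsetSum m (fun o => Int.sign (o + k)) = ((min m k : ℕ) : ℤ) := by
  simp only [sign_eq_ite]
  induction m using Nat.twoStepInduction with
  | zero => simp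
  | one => rw [offsetSum_one]; omega
  | more m ih _ => rw [offsetSum_add_two, ih]; omega

/-- The alternatives are the values of `t / t_a`, `t / t_b`, `t (α_a | α_b)` for two non-orthogonal
simple roots, divided by `t / t_a` when the lengths agree. The condition `0 < k` in the diagonal
case is needed because the empty double sum is 0. -/
lemma offsetSum_offsetSum_sign {A B f : ℤ} {T : ℕ → ℕ → ℤ}
    (h : (A = 1 ∧ B = 1 ∧ f = -1 ∧ ∀ m k, T m k = (min m k : ℕ)) ∨
      (A = 1 ∧ B = 1 ∧ f = 2 ∧ ∀ m k, T m k = -2 * (min m k : ℕ) + if m = k ∧ 0 < k then 1 else 0) ∨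
      (A = 2 ∧ B = 1 ∧ f = -2 ∧ ∀ m k, T m k = (min (2 * m) k : ℕ)) ∨
      (A = 3 ∧ B = 1 ∧ f = -3 ∧ ∀ m k, T m k = (min (3 * m) k : ℕ)) ∨
      (A = 1 ∧ B = 2 ∧ f = -2 ∧ ∀ m k, T m k = (min m (2 * k) : ℕ)) ∨
      (A = 1 ∧ B = 3 ∧ f = -3 ∧ ∀ m k, T m k = (min m (3 * k) : ℕ)))
    (m k : ℕ) :
    offsetSum m (fun o => offsetSum k (fun o' => Int.sign (A * o - B * o' - f))) = T m k := by
  simp only [sign_eq_ite]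
  -- The new outer pair of the `m`-string contributes a difference of `T` in `m`, which is itself
  -- proved by two-step induction in `k`.
  have key : ∀ n k : ℕ,
      offsetSum k (fun o' => (if 0 < A * (n + 1) - B * o' - f then 1 else 0)
          - (if A * (n + 1) - B * o' - f < 0 then 1 else 0))
        + offsetSum k (fun o' => (if 0 < A * (-(n + 1)) - B * o' - f then 1 else 0)
          - (if A * (-(n + 1)) - B * o' - f < 0 then 1 else 0)) = T (n + 2) k - T n k := by
    intro n k
    rcases h with ⟨rfl, rfl, rfl, hT⟩ | ⟨rfl, rfl, rfl, hT⟩ | ⟨rfl, rfl, rfl, hT⟩ |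
      ⟨rfl, rfl, rfl, hT⟩ | ⟨rfl, rfl, rfl, hT⟩ | ⟨rfl, rfl, rfl, hT⟩
    all_goals
      rw [hT, hT]
      induction k using Nat.twoStepInduction with
      | zero => simp
      | one => simp only [offsetSum_one]; omega
      | more k ih _ => rw [offsetSum_add_two, offsetSum_add_two]; omega
  induction m using Nat.twoStepInduction with
  | zero =>
    rcases h with ⟨rfl, rfl, rfl, hT⟩ | ⟨rfl, rfl, rfl, hT⟩ | ⟨rfl, rfl, rfl, hT⟩ |
      ⟨rfl, rfl, rfl, hT⟩ | ⟨rfl, rfl, rfl, hT⟩ | ⟨rfl, rfl, rfl, hT⟩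
    all_goals (rw [hT]; simp [offsetSum]; try omega)
  | one =>
    rw [offsetSum_one]
    rcases h with ⟨rfl, rfl, rfl, hT⟩ | ⟨rfl, rfl, rfl, hT⟩ | ⟨rfl, rfl, rfl, hT⟩ |
      ⟨rfl, rfl, rfl, hT⟩ | ⟨rfl, rfl, rfl, hT⟩ | ⟨rfl, rfl, rfl, hT⟩
    all_goals
      rw [hT]
      induction k using Nat.twoStepInduction with
      | zero => simp
      | one => simp only [offsetSum_one]; first | omega | norm_num
      | more k ih _ => rw [offsetSum_add_two]; omega
  | more m ih _ =>
    rw [offsetSum_add_two, ih]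
    have := key m k
    linarith

/-- The same root data, with a single offset `r` against a whole `k`-string. The point corrections
in the third and fourth alternatives are the source of `Delta`. -/
lemma offsetSum_min_sub_min {A B f : ℤ} {T : ℕ → ℕ → ℤ}
    (h : (A = 1 ∧ B = 1 ∧ f = -1 ∧ ∀ m k, T m k = (min m k : ℕ)) ∨
      (A = 1 ∧ B = 1 ∧ f = 2 ∧ ∀ m k, T m k = -2 * (min m k : ℕ) + if m = k then 1 else 0) ∨
      (A = 2 ∧ B = 1 ∧ f = -2 ∧
        ∀ m k, T m k = 2 * (min (2 * m) k : ℕ) - if k = 2 * m then 1 else 0) ∨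
      (A = 3 ∧ B = 1 ∧ f = -3 ∧
        ∀ m k, T m k = 3 * (min (3 * m) k : ℕ) - ((if k = 3 * m - 1 then 1 else 0)
          + 2 * (if k = 3 * m then 1 else 0) + (if k = 3 * m + 1 then 1 else 0))) ∨
      (A = 1 ∧ B = 2 ∧ f = -2 ∧ ∀ m k, T m k = (min m (2 * k) : ℕ)) ∨
      (A = 1 ∧ B = 3 ∧ f = -3 ∧ ∀ m k, T m k = (min m (3 * k) : ℕ)))
    {r : ℕ} (hr : 0 < r) (k : ℕ) :
    offsetSum k (fun o => min (A * r + f) (B * o) - min (A * r) (B * o + f)) = T r k := by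
  rcases h with ⟨rfl, rfl, rfl, hT⟩ | ⟨rfl, rfl, rfl, hT⟩ | ⟨rfl, rfl, rfl, hT⟩ |
    ⟨rfl, rfl, rfl, hT⟩ | ⟨rfl, rfl, rfl, hT⟩ | ⟨rfl, rfl, rfl, hT⟩
  all_goals
    rw [hT]
    induction k using Nat.twoStepInduction with
    | zero => simp; try omega
    | one => simp only [offsetSum_one]; omega
    | more k ih _ => rw [offsetSum_add_two]; omega

/-! ### Pairs of simple roots, case by case -/

namespace CartanType

variable (X : CartanType)

lemma t_eq_one_or_two_or_three (a : X.Color) : X.t a = 1 ∨ X.t a = 2 ∨ X.t a = 3 := by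
  cases X <;> simp only [t, tLabel] <;> (try split_ifs) <;> simp

lemma tquot_pos (a : X.Color) : 0 < X.tquot a := by
  have h : X.t a ≤ X.tmax := Finset.le_sup (f := X.t) (Finset.mem_univ a)
  exact Nat.div_pos h (X.t_pos a)

lemma tquot_of_t_eq {a b : X.Color} (h : X.t a = X.t b) : X.tquot a = X.tquot b := by
  unfold tquot; rw [h]

lemma tmax_of_t_ne_one {b : X.Color} (hb : X.t b ≠ 1) : X.tmax = X.t b := by
  obtain ⟨c, hc, h⟩ := X.t_cases
  refine le_antisymm (Finset.sup_le fun d _ => ?_) (Finset.le_sup (f := X.t) (Finset.mem_univ b))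
  have := h d
  have := h b
  have := X.t_pos b
  omega

/-- The possible data of a pair of simple roots. -/
lemma color_cases (a b : X.Color) :
    (a = b ∧ X.cartan a b = 2 ∧ X.t a = X.t b ∧ X.tquot a = X.tquot b) ∨
    (a ≠ b ∧ X.cartan a b = 0) ∨
    (a ≠ b ∧ X.cartan a b = -1 ∧ X.t a = X.t b ∧ X.tquot a = X.tquot b) ∨
    (a ≠ b ∧ X.cartan a b = -1 ∧ X.t a = 1 ∧ (X.t b = 2 ∨ X.t b = 3) ∧ X.tquot a = X.t b ∧
      X.tquot b = 1) ∨
    (a ≠ b ∧ X.cartan a b = -X.t a ∧ X.t b = 1 ∧ (X.t a = 2 ∨ X.t a = 3) ∧ X.tquot a = 1 ∧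
      X.tquot b = X.t a) := by
  by_cases hab : a = b
  · subst hab; left; simp [cartan]
  right
  by_cases hadj : X.Adj a b
  swap
  · left; simp [cartan, hab, hadj]
  right
  have ha := X.t_eq_one_or_two_or_three a
  have hb := X.t_eq_one_or_two_or_three b
  have hap := X.t_pos a
  have hbp := X.t_pos b
  by_cases hA : X.t a = 1 <;> by_cases hB : X.t b = 1
  · left; exact ⟨hab, by simp [cartan, hab, hadj, hA, hB], by rw [hA, hB],
      X.tquot_of_t_eq (by rw [hA, hB])⟩
  · right; left
    have hm := X.tmax_of_t_ne_one hB
    refine ⟨hab, by (simp [cartan, hab, hadj, hA]; try omega), hA, by omega, ?_, ?_⟩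
    · simp [tquot, hm, hA]
    · simp [tquot, hm, hbp]
  · right; right
    have hm := X.tmax_of_t_ne_one hA
    refine ⟨hab, by (simp [cartan, hab, hadj, hB]; try omega), hB, by omega, ?_, ?_⟩
    · simp [tquot, hm, hap]
    · simp [tquot, hm, hB]
  · left
    have h : X.t a = X.t b := by
      obtain ⟨c, hc, h⟩ := X.t_cases
      have := h a
      have := h b
      omega
    exact ⟨hab, by simp [cartan, hab, hadj, h], h, X.tquot_of_t_eq h⟩

lemma formMin_of_t_eq {a b : X.Color} (h : X.t a = X.t b) (m k : ℕ) :
    X.formMin a m b k = X.cartan a b * (min m k : ℕ) := by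
  have hp : (X.t a : ℤ) ≠ 0 := by exact_mod_cast (X.t_pos a).ne'
  unfold formMin
  rw [← h, show min (X.t a * m) (X.t a * k) = X.t a * min m k from Nat.mul_min_mul_left ..]
  push_cast
  rw [mul_left_comm, Int.mul_ediv_cancel_left _ hp]

end CartanType

/-! ### Offset sums for the root data -/

open CartanType

variable {X : CartanType}

lemma offsetSum_neg (k : ℕ) (φ : ℤ → ℤ) : offsetSum k (fun o => φ (-o)) = offsetSum k φ := by
  induction k using Nat.twoStepInduction with
  | zero => simp
  | one => simp
  | more k ih _ => rw [offsetSum_add_two, offsetSum_add_two, ih, neg_neg]; ring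

/-- These numbers, up to sign, are the exponents that appear when the factors `G` of two strings are
reflected; they produce the off-diagonal structure of `matA`. -/
lemma offsetSum_offsetSum_sign_eq_formMin (a b : X.Color) (m k : ℕ) :
    offsetSum m (fun o => offsetSum k (fun o' =>
      Int.sign (X.tquot a * o - X.tquot b * o' - X.formT a b))) =
      -X.formMin a m b k + if a = b ∧ m = k ∧ 0 < k then 1 else 0 := by
  have hq : (0 : ℤ) < X.tquot a := by exact_mod_cast X.tquot_pos a
  have scale : X.tquot a = X.tquot b → ∀ o o' : ℤ,
      Int.sign (X.tquot a * o - X.tquot b * o' - X.formT a b) =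
        Int.sign (1 * o - 1 * o' - X.cartan a b) := by
    intro h o o'
    rw [← h, formT, ← mul_sub, ← mul_sub, Int.sign_mul, Int.sign_eq_one_of_pos hq]
    simp
  rcases X.color_cases a b with ⟨e, hC, ht, hT⟩ | ⟨e, hC⟩ | ⟨e, hC, ht, hT⟩ |
    ⟨e, hC, ha, hb, hA, hB⟩ | ⟨e, hC, hb, ha, hA, hB⟩
  · simp only [scale hT, X.formMin_of_t_eq ht, hC]
    refine (offsetSum_offsetSum_sign (Or.inr (Or.inl ⟨rfl, rfl, rfl, fun m k => rfl⟩)) m k).trans ?_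
    simp [e]
  -- For orthogonal roots the summand is odd under reflecting both offsets, so the double sum is its
  -- own negative.
  · have h := offsetSum_neg m (fun o => offsetSum k (fun o' =>
      Int.sign (X.tquot a * o - X.tquot b * o' - X.formT a b)))
    have h2 : ∀ o : ℤ, offsetSum k (fun o' =>
        Int.sign (X.tquot a * (-o) - X.tquot b * o' - X.formT a b)) =
        (-1) * offsetSum k (fun o' =>
          Int.sign (X.tquot a * o - X.tquot b * o' - X.formT a b)) := fun o => by
      rw [← offsetSum_neg, ← offsetSum_const_mul]
      refine offsetSum_congr fun o' => ?_
      rw [neg_one_mul, ← Int.sign_neg]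
      simp only [formT, hC]
      ring_nf
    simp only [h2, offsetSum_const_mul] at h
    simp only [formMin, hC, e]
    simp
    linarith
  · simp only [scale hT, X.formMin_of_t_eq ht, hC]
    refine (offsetSum_offsetSum_sign (Or.inl ⟨rfl, rfl, rfl, fun m k => rfl⟩) m k).trans ?_
    simp [e]
  · simp only [formMin, hC, formT, ha, hA, hB, e]
    rcases hb with hb | hb <;> rw [hb]
    · refine (offsetSum_offsetSum_sign
        (T := fun m k => (min (2 * m) k : ℕ)) (by simp) m k).trans ?_
      simp
    · refine (offsetSum_offsetSum_sign
        (T := fun m k => (min (3 * m) k : ℕ)) (by simp) m k).trans ?_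
      simp
  · simp only [formMin, hC, formT, hb, hA, hB, e]
    rcases ha with ha | ha <;> rw [ha]
    · refine (offsetSum_offsetSum_sign
        (T := fun m k => (min m (2 * k) : ℕ)) (by simp) m k).trans ?_
      simp; omega
    · refine (offsetSum_offsetSum_sign
        (T := fun m k => (min m (3 * k) : ℕ)) (by simp) m k).trans ?_
      simp; omega

/-- The contribution of one string of length `k` and colour `b` to `Δ_r^{(a)}`. -/
def deltaTerm (a b : X.Color) (r k : ℕ) : ℤ :=
  if X.t a = 1 ∧ X.t b ≠ 1 ∧ X.cartan a b ≠ 0 then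
    if X.t b = 2 then -(if k = 2 * r then 1 else 0)
    else -((if k = 3 * r - 1 then 1 else 0) + 2 * (if k = 3 * r then 1 else 0)
      + (if k = 3 * r + 1 then 1 else 0))
  else 0

/-- The contribution of one string to the slope. The Kronecker delta and `deltaTerm` both correct
`min (t_b r, t_a k)` near its corner; the latter occurs only for a long root next to a shorter one.
-/
lemma offsetSum_min_eq_formMin (a b : X.Color) {r : ℕ} (hr : 0 < r) (k : ℕ) :
    offsetSum k (fun o => min (X.tquot a * r + X.formT a b) (X.tquot b * o)
      - min (X.tquot a * (r : ℤ)) (X.tquot b * o + X.formT a b)) =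
      X.tquot a * (-X.formMin a r b k + if a = b ∧ r = k then 1 else 0) + deltaTerm a b r k := by
  have hq : (0 : ℤ) < X.tquot a := by exact_mod_cast X.tquot_pos a
  have scale : X.tquot a = X.tquot b → ∀ o : ℤ,
      min (X.tquot a * r + X.formT a b) (X.tquot b * o)
        - min (X.tquot a * (r : ℤ)) (X.tquot b * o + X.formT a b) =
      X.tquot a * (min (1 * r + X.cartan a b) (1 * o) - min (1 * (r : ℤ)) (1 * o + X.cartan a b)) := by
    intro h o
    rw [← h, formT, ← mul_add, ← mul_add, ← mul_min_of_nonneg _ _ hq.le,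
      ← mul_min_of_nonneg _ _ hq.le]
    ring_nf
  rcases X.color_cases a b with ⟨e, hC, ht, hT⟩ | ⟨e, hC⟩ | ⟨e, hC, ht, hT⟩ |
    ⟨e, hC, ha, hb, hA, hB⟩ | ⟨e, hC, hb, ha, hA, hB⟩
  · have hd : deltaTerm a b r k = 0 := if_neg (by rw [ht]; tauto)
    simp only [scale hT, X.formMin_of_t_eq ht, hC, hd, offsetSum_const_mul]
    rw [offsetSum_min_sub_min (Or.inr (Or.inl ⟨rfl, rfl, rfl, fun m k => rfl⟩)) hr k]
    simp [e]
  · have hd : deltaTerm a b r k = 0 := if_neg (by tauto)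
    simp [hd, e, formMin, formT, hC, offsetSum]
  · have hd : deltaTerm a b r k = 0 := if_neg (by rw [ht]; tauto)
    simp only [scale hT, X.formMin_of_t_eq ht, hC, hd, offsetSum_const_mul]
    rw [offsetSum_min_sub_min (Or.inl ⟨rfl, rfl, rfl, fun m k => rfl⟩) hr k]
    simp [e]
  · simp only [formMin, hC, formT, ha, hA, hB, e, deltaTerm]
    rcases hb with hb | hb <;> rw [hb]
    · refine (offsetSum_min_sub_min
        (T := fun m k => 2 * (min (2 * m) k : ℕ) - if k = 2 * m then 1 else 0)
          (by simp) hr k).trans ?_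
      simp; try ring
    · refine (offsetSum_min_sub_min (T := fun m k =>
          3 * (min (3 * m) k : ℕ) - ((if k = 3 * m - 1 then 1 else 0)
          + 2 * (if k = 3 * m then 1 else 0) + (if k = 3 * m + 1 then 1 else 0)))
          (by simp) hr k).trans ?_
      simp; try ring
  · have hd : deltaTerm a b r k = 0 := if_neg (by tauto)
    simp only [formMin, hC, formT, hb, hA, hB, e, hd]
    rcases ha with ha | ha <;> rw [ha]
    · refine (offsetSum_min_sub_min
        (T := fun m k => (min m (2 * k) : ℕ)) (by simp) hr k).trans ?_
      simp; omega
    · refine (offsetSum_min_sub_min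
        (T := fun m k => (min m (3 * k) : ℕ)) (by simp) hr k).trans ?_
      simp; omega

/-! ### Slopes and the forced orders ζ -/

variable {N : X.Pattern}

/-- The reflection of a string. -/
def Root.rev (v : Root N) : Root N := ⟨v.1, Fin.rev v.2⟩

@[simp] lemma Root.rev_rev (v : Root N) : v.rev.rev = v := by
  simp [Root.rev]

lemma Root.offset_eq (v : Root N) : v.offset = (v.1.len : ℤ) - 1 - 2 * (v.2 : ℕ) := by
  unfold Root.offset; ring

lemma Root.offset_rev (v : Root N) : v.rev.offset = -v.offset := by
  have := v.2.isLt
  simp only [Root.offset_eq, Root.rev, Fin.val_rev]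
  omega

@[simp] lemma Root.color_rev (v : Root N) : v.rev.color = v.color := rfl

lemma Root.d_rev (v : Root N) : v.rev.d = -v.d := by
  unfold Root.d; rw [Root.offset_rev, Root.color_rev]; ring

lemma sum_str {M : Type*} [AddCommMonoid M] (g : X.Color → ℕ → M) :
    ∑ s : Str N, g s.color s.len = ∑ p ∈ N.support, N p • g p.1 (p.2 : ℕ) := by
  rw [Fintype.sum_sigma, ← Finset.sum_coe_sort N.support]
  refine Finset.sum_congr rfl fun p _ => ?_
  simp [Str.color, Str.len]

lemma sum_root (s : Str N) (φ : ℤ → ℤ) :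
    ∑ i : Fin s.len, φ (Root.offset (⟨s, i⟩ : Root N)) = offsetSum s.len φ := by
  simp only [Root.offset_eq]
  exact Fin.sum_univ_eq_sum_range (fun i => φ ((s.len : ℤ) - 1 - 2 * (i : ℤ))) s.len

/-- The excess of `ord (F_- G_+)` over `ord (F_+ G_-)`, not counting the contribution of the
neighbours in the string, for a root of colour `a` and offset `o`. -/
def slope (ν N : X.Pattern) (a : X.Color) (o : ℤ) : ℤ :=
  (X.tquot a : ℤ) * (∑ p ∈ ν.support with p.1 = a,
      (ν p : ℤ) * (min o ((p.2 : ℕ) : ℤ) - min (o + ((p.2 : ℕ) : ℤ)) 0))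
    + ∑ s : Str N, offsetSum s.len (fun o' =>
      min (X.tquot a * o + X.formT a s.color) (X.tquot s.color * o')
        - min (X.tquot a * o) (X.tquot s.color * o' + X.formT a s.color))

lemma slope_eq (ν : X.Pattern) (v : Root N) :
    slope ν N v.color v.offset = xiMinus ν v + etaPlus v - xiPlus ν v - etaMinus v := by
  have h : etaPlus v - etaMinus v = ∑ s : Str N, offsetSum s.len (fun o' =>
      min (X.tquot v.color * v.offset + X.formT v.color s.color) (X.tquot s.color * o')
        - min (X.tquot v.color * v.offset) (X.tquot s.color * o' + X.formT v.color s.color)) := by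
    unfold etaPlus etaMinus
    rw [← Finset.sum_sub_distrib, Fintype.sum_sigma]
    refine Finset.sum_congr rfl fun s _ => ?_
    rw [← sum_root]
    refine Finset.sum_congr rfl fun i _ => ?_
    simp only [Root.d, Root.color, mul_comm]
  have h2 : xiMinus ν v - xiPlus ν v = (X.tquot v.color : ℤ) *
      (∑ p ∈ ν.support with p.1 = v.color,
      (ν p : ℤ) * (min v.offset ((p.2 : ℕ) : ℤ) - min (v.offset + ((p.2 : ℕ) : ℤ)) 0)) := by
    unfold xiMinus xiPlus
    rw [← mul_sub, ← Finset.sum_sub_distrib]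
    simp only [mul_sub]
  rw [slope, ← h, ← h2]
  ring

/-- The `ν` terms are odd one by one; the string terms become odd after the substitution `o' ↦ -o'`,
which exchanges the two minima. -/
lemma slope_neg (ν N : X.Pattern) (a : X.Color) (o : ℤ) : slope ν N a (-o) = -slope ν N a o := by
  unfold slope
  rw [neg_add, ← mul_neg, ← Finset.sum_neg_distrib, ← Finset.sum_neg_distrib]
  congr 1
  · congr 1
    refine Finset.sum_congr rfl fun p _ => ?_
    rw [← mul_neg]
    congr 1
    omega
  · refine Finset.sum_congr rfl fun s _ => ?_
    rw [← offsetSum_neg, ← neg_one_mul (offsetSum _ _), ← offsetSum_const_mul]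
    refine offsetSum_congr fun o' => ?_
    rw [mul_neg, mul_neg]
    omega

lemma count_eq_sum (a : X.Color) (j : ℕ) :
    count N a j = ∑ s : Str N, if a = s.color ∧ j = s.len then 1 else 0 := by
  rw [sum_str (fun b k => if a = b ∧ j = k then (1 : ℤ) else 0)]
  unfold count
  split_ifs with hj
  · rw [Finset.sum_eq_single ((a, ⟨j, hj⟩) : X.H)]
    · simp
    · rintro ⟨b, k⟩ _ hne
      rw [if_neg, smul_zero]
      rintro ⟨rfl, rfl⟩
      exact hne rfl
    · intro h
      simp only [Finsupp.mem_support_iff, not_not] at h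
      simp [h]
  · refine (Finset.sum_eq_zero fun p _ => ?_).symm
    rw [if_neg, smul_zero]
    rintro ⟨_, rfl⟩
    exact hj p.2.pos

lemma Delta_eq_sum (a : X.Color) (j : ℕ) :
    Delta N a j = ∑ s : Str N, deltaTerm a s.color j s.len := by
  have h : ∀ s : Str N, deltaTerm a s.color j s.len =
      ∑ b : X.Color with X.t a = 1 ∧ X.t b ≠ 1 ∧ X.cartan a b ≠ 0,
        if X.t b = 2 then -(if b = s.color ∧ 2 * j = s.len then 1 else 0)
        else -((if b = s.color ∧ 3 * j - 1 = s.len then 1 else 0)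
          + 2 * (if b = s.color ∧ 3 * j = s.len then 1 else 0)
          + (if b = s.color ∧ 3 * j + 1 = s.len then 1 else 0)) := by
    intro s
    rw [Finset.sum_filter, Finset.sum_eq_single s.color]
    · simp [deltaTerm, eq_comm]
    · intro b _ hb
      simp [hb]
    · simp
  simp only [h]
  rw [Finset.sum_comm]
  unfold Delta
  refine Finset.sum_congr rfl fun b _ => ?_
  simp only [count_eq_sum]
  split_ifs
  · rw [Finset.sum_neg_distrib]
  · rw [Finset.sum_neg_distrib, Finset.mul_sum, Finset.sum_add_distrib, Finset.sum_add_distrib]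

/-- Links the forced orders to the hypothesis: the right-hand side is the summand of
`OrderCondition`. Positivity of `r` matters, since the other half of the string is reached only
through `slope_neg`. -/
lemma slope_natCast (ν N : X.Pattern) (a : X.Color) {r : ℕ} (hr : 0 < r) :
    slope ν N a r = X.tquot a * (vacancy ν N a r + count N a r) + Delta N a r := by
  have h1 : ∑ p ∈ ν.support with p.1 = a,
      (ν p : ℤ) * (min (r : ℤ) ((p.2 : ℕ) : ℤ) - min ((r : ℤ) + ((p.2 : ℕ) : ℤ)) 0) =
      gamma ν a r := by
    refine Finset.sum_congr rfl fun p _ => ?_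
    rw [mul_comm]
    congr 1
    push_cast
    omega
  have h2 : ∑ p ∈ N.support, X.formMin a r p.1 (p.2 : ℕ) * (N p : ℤ) =
      ∑ s : Str N, X.formMin a r s.color s.len := by
    rw [sum_str (fun b k => X.formMin a r b k)]
    refine Finset.sum_congr rfl fun p _ => ?_
    rw [nsmul_eq_mul, mul_comm]
  simp only [slope, h1, offsetSum_min_eq_formMin _ _ hr]
  rw [Finset.sum_add_distrib, ← Delta_eq_sum, ← Finset.mul_sum, Finset.sum_add_distrib,
    Finset.sum_neg_distrib, ← count_eq_sum, vacancy, h2]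
  ring

/-- The order of `x̃_{i+1} - x̃_i` in generic string solutions; the members of the string are
counted from `0`, and `zetaOrd s i` belongs to the members `i - 1` and `i`. -/
def zetaOrd (ν : X.Pattern) (s : Str N) (i : ℕ) : ℤ :=
  ∑ j ∈ Finset.range i, slope ν N s.color ((s.len : ℤ) - 1 - 2 * (j : ℤ))

@[simp] lemma zetaOrd_zero (ν : X.Pattern) (s : Str N) : zetaOrd ν s 0 = 0 := rfl

lemma zetaOrd_succ (ν : X.Pattern) (v : Root N) :
    zetaOrd ν v.1 ((v.2 : ℕ) + 1) =
      zetaOrd ν v.1 v.2 + (xiMinus ν v + etaPlus v - xiPlus ν v - etaMinus v) := by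
  rw [← slope_eq, Root.offset_eq]
  exact Finset.sum_range_succ _ _

-- An odd function sums to zero over the symmetric set of offsets. This makes the convention `ζ = 0`
-- at both ends consistent.
@[simp] lemma zetaOrd_len (ν : X.Pattern) (s : Str N) : zetaOrd ν s s.len = 0 := by
  have h := offsetSum_neg s.len (slope ν N s.color)
  simp only [slope_neg, ← neg_one_mul (slope ν N s.color _), offsetSum_const_mul] at h
  change offsetSum s.len (slope ν N s.color) = 0
  linarith

lemma zetaOrd_len_sub (ν : X.Pattern) (s : Str N) {i : ℕ} (hi : i ≤ s.len) :
    zetaOrd ν s (s.len - i) = zetaOrd ν s i := by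
  induction i with
  | zero => simp
  | succ i ih =>
    have h := ih (by omega)
    rw [show s.len - i = s.len - (i + 1) + 1 by omega] at h
    unfold zetaOrd at h ⊢
    rw [Finset.sum_range_succ] at h ⊢
    have h2 : (s.len : ℤ) - 1 - 2 * ((s.len - (i + 1) : ℕ) : ℤ) = -((s.len : ℤ) - 1 - 2 * i) := by
      omega
    rw [h2, slope_neg] at h
    linarith

/-- By the symmetry `zetaOrd_len_sub` one may stay in the first half of the string, where all
offsets are positive and the partial sum of slopes is the sum in the order condition. -/
lemma zetaOrd_pos {ν : X.Pattern} (hN : OrderCondition ν N) (s : Str N) {i : ℕ} (hi : 0 < i)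
    (hi' : i < s.len) : 0 < zetaOrd ν s i := by
  have h : zetaOrd ν s i = zetaOrd ν s (min i (s.len - i)) := by
    rcases min_choice i (s.len - i) with h | h <;> rw [h]
    rw [zetaOrd_len_sub _ _ hi'.le]
  rw [h]
  -- Links are counted from 0 and positions from 1, hence `i + 1`; likewise `j = k - 1` in the
  -- reindexing below.
  have key := hN s.1.1 s.1.2 (i + 1) (by omega) hi'
  have e : min (i + 1 - 1) ((s.1.1.2 : ℕ) + 1 - (i + 1)) = min i (s.len - i) := by
    change min (i + 1 - 1) (s.len + 1 - (i + 1)) = _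
    omega
  rw [e] at key
  convert key using 1
  unfold zetaOrd
  refine Finset.sum_nbij' (· + 1) (· - 1) (fun j hj => ?_) (fun k hk => ?_) (fun j _ => ?_)
    (fun k hk => ?_) (fun j hj => ?_)
  · simp only [Finset.mem_range, Finset.mem_Icc] at *; omega
  · simp only [Finset.mem_range, Finset.mem_Icc] at *; omega
  · simp
  · simp only [Finset.mem_Icc] at hk; omega
  · simp only [Finset.mem_range] at hj
    change _ = (X.tquot s.color : ℤ) * (vacancy ν N s.color (s.len + 1 - 2 * (j + 1))
      + count N s.color (s.len + 1 - 2 * (j + 1))) + Delta N s.color (s.len + 1 - 2 * (j + 1))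
    rw [← slope_natCast _ _ _ (by omega)]
    congr 1
    omega

/-! ### Coordinates and extraction of the powers of `q` -/

/-- The polynomial `q ^ e X - Y`, multiplied by `q ^ (-e)` if `e` is negative. -/
def bracket (e : ℤ) (q x y : ℂ) : ℂ := q ^ e.toNat * x - q ^ (-e).toNat * y

lemma zpow_mul_sub_zpow_mul {q : ℂ} (hq : q ≠ 0) (m n : ℤ) (x y : ℂ) :
    q ^ m * x - q ^ n * y = q ^ min m n * bracket (m - n) q x y := by
  unfold bracket
  rw [mul_sub, ← mul_assoc, ← mul_assoc, ← zpow_natCast, ← zpow_natCast, ← zpow_add₀ hq,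
    ← zpow_add₀ hq]
  congr 3 <;> omega

lemma bracket_zero_right (e : ℤ) (x y : ℂ) :
    bracket e 0 x y = if e < 0 then x else if e = 0 then x - y else -y := by
  unfold bracket
  rcases lt_trichotomy e 0 with h | h | h
  · simp [h, show e.toNat = 0 by omega, show (-e).toNat ≠ 0 by omega]
  · simp [h]
  · simp [h.not_gt, h.ne', show e.toNat ≠ 0 by omega, show (-e).toNat = 0 by omega]

/-- `w` is the successor of `v` in a string. -/
def IsNext (v w : Root N) : Prop := v.1 = w.1 ∧ (w.2 : ℕ) = v.2 + 1

instance (v w : Root N) : Decidable (IsNext v w) := by unfold IsNext; infer_instance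

lemma Root.ext' {v w : Root N} (h : v.1 = w.1) (h' : (v.2 : ℕ) = w.2) : v = w := by
  obtain ⟨s, i⟩ := v
  obtain ⟨s', j⟩ := w
  obtain rfl : s = s' := h
  congr 1
  exact Fin.ext h'

lemma prod_isNext_left (v : Root N) (c : ℂ) :
    ∏ w : Root N, (if IsNext w v then c else 1) = if 0 < (v.2 : ℕ) then c else 1 := by
  have hv := v.2.isLt
  split_ifs with h
  · rw [Finset.prod_eq_single (⟨v.1, ⟨(v.2 : ℕ) - 1, by omega⟩⟩ : Root N), if_pos]
    · exact ⟨rfl, by simp only; omega⟩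
    · intro w _ hw
      rw [if_neg]
      rintro ⟨h1, h2⟩
      exact hw (Root.ext' h1 (by simp only; omega))
    · simp
  · refine Finset.prod_eq_one fun w _ => if_neg ?_
    rintro ⟨h1, h2⟩
    omega

lemma prod_isNext_right (v : Root N) (c : ℂ) :
    ∏ w : Root N, (if IsNext v w then c else 1) = if (v.2 : ℕ) + 1 < v.1.len then c else 1 := by
  split_ifs with h
  · rw [Finset.prod_eq_single (⟨v.1, ⟨(v.2 : ℕ) + 1, h⟩⟩ : Root N), if_pos]
    · exact ⟨rfl, rfl⟩
    · intro w _ hw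
      rw [if_neg]
      rintro ⟨h1, h2⟩
      exact hw (Root.ext' h1.symm h2)
    · simp
  · refine Finset.prod_eq_one fun w _ => if_neg ?_
    rintro ⟨h1, h2⟩
    have hw := w.2.isLt
    have : v.1.len = w.1.len := by rw [h1]
    omega

/-- The step `2 t / t_a` of a string equals `t (α_a | α_a)`. Hence the leading terms of neighbours
cancel in `G`, which is why ζ enters its order. -/
lemma IsNext.d_eq {v w : Root N} (h : IsNext v w) :
    v.d = w.d + X.formT v.color w.color := by
  obtain ⟨s, i⟩ := v
  obtain ⟨s', j⟩ := w
  obtain ⟨h1, h2⟩ := h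
  obtain rfl : s = s' := h1
  simp only at h2
  simp only [Root.d, Root.offset, Root.color, formT, cartan, if_true, h2]
  push_cast
  ring

lemma IsNext.color_eq {v w : Root N} (h : IsNext v w) : v.color = w.color := by
  unfold Root.color; rw [h.1]

/-- The coordinates attached to the inner links of a string; the ends carry the value `1`. -/
def link (u : Root N → ℂ) (s : Str N) (i : ℕ) : ℂ :=
  if h : 0 < i ∧ i < s.len then u ⟨s, ⟨i, h.2⟩⟩ else 1

@[simp] lemma link_zero (u : Root N → ℂ) (s : Str N) : link u s 0 = 1 := by simp [link]

@[simp] lemma link_len (u : Root N → ℂ) (s : Str N) : link u s s.len = 1 := by simp [link]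

/-- The normalized series as functions of `q` and of the coordinates `u`: the coordinate of the
first member of a string is that member itself, the other ones are the differences of consecutive
members, divided by powers of `q`. -/
def xTilde (ν : X.Pattern) (q : ℂ) (u : Root N → ℂ) (v : Root N) : ℂ :=
  ∑ j : Fin v.1.len, if j ≤ v.2 then q ^ (zetaOrd ν v.1 j).toNat * u ⟨v.1, j⟩ else 0

lemma xTilde_first (ν : X.Pattern) (q : ℂ) (u : Root N → ℂ) (s : Str N) :
    xTilde ν q u s.first = u s.first := by
  unfold xTilde
  change (∑ j : Fin s.len, if j ≤ s.first.2 then q ^ (zetaOrd ν s j).toNat * u ⟨s, j⟩ else 0) = _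
  rw [Finset.sum_eq_single (⟨0, s.len_pos⟩ : Fin s.len)]
  · simp [Str.first]
  · intro j _ hj
    rw [if_neg]
    intro h
    exact hj (Fin.ext (Nat.le_zero.1 h))
  · simp

lemma xTilde_sub (ν : X.Pattern) (q : ℂ) (u : Root N → ℂ) {v w : Root N} (h : IsNext v w) :
    xTilde ν q u w - xTilde ν q u v = q ^ (zetaOrd ν w.1 w.2).toNat * u w := by
  obtain ⟨s, i⟩ := v
  obtain ⟨s', j⟩ := w
  obtain ⟨h1, h2⟩ := h
  obtain rfl : s = s' := h1
  simp only at h2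
  unfold xTilde
  rw [← Finset.sum_sub_distrib, Finset.sum_eq_single j]
  · simp [Fin.le_def, h2]
  · intro k _ hk
    have : (k : ℕ) ≠ j := fun h => hk (Fin.ext h)
    by_cases hki : k ≤ i
    · rw [if_pos hki, if_pos, sub_self]
      simp only [Fin.le_def] at *; omega
    · rw [if_neg hki, if_neg, sub_self]
      simp only [Fin.le_def] at *; omega
  · simp

/-- `F_+` without its power of `q`. -/
def normFplus (ν : X.Pattern) (v : Root N) (q : ℂ) (u : Root N → ℂ) : ℂ :=
  ∏ p ∈ ν.support with p.1 = v.color,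
    bracket (X.tquot v.color * (v.offset + (p.2 : ℕ))) q (xTilde ν q u v) 1 ^ ν p

/-- `F_-` without its power of `q`. -/
def normFminus (ν : X.Pattern) (v : Root N) (q : ℂ) (u : Root N → ℂ) : ℂ :=
  ∏ p ∈ ν.support with p.1 = v.color,
    bracket (X.tquot v.color * (v.offset - (p.2 : ℕ))) q (xTilde ν q u v) 1 ^ ν p

/-- The part of `G_+` that does not involve the neighbours in the string, without its power
of `q`. -/
def normGplus (ν : X.Pattern) (v : Root N) (q : ℂ) (u : Root N → ℂ) : ℂ :=
  ∏ w : Root N, if IsNext w v then 1 else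
    bracket (v.d + X.formT v.color w.color - w.d) q (xTilde ν q u v) (xTilde ν q u w)

/-- The part of `G_-` that does not involve the neighbours in the string, without its power
of `q`. -/
def normGminus (ν : X.Pattern) (v : Root N) (q : ℂ) (u : Root N → ℂ) : ℂ :=
  ∏ w : Root N, if IsNext v w then 1 else
    bracket (v.d - X.formT v.color w.color - w.d) q (xTilde ν q u v) (xTilde ν q u w)

/-- The sign contributed by the successor in the string. -/
def nextSign (v : Root N) : ℂ := if (v.2 : ℕ) + 1 < v.1.len then -1 else 1

lemma nextSign_ne_zero (v : Root N) : nextSign v ≠ 0 := by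
  unfold nextSign; split_ifs <;> simp

lemma zpow_sum {ι : Type*} {q : ℂ} (hq : q ≠ 0) (t : Finset ι) (f : ι → ℤ) :
    q ^ ∑ i ∈ t, f i = ∏ i ∈ t, q ^ f i := by
  classical
  induction t using Finset.induction_on with
  | empty => simp
  | insert i t hi ih => rw [Finset.sum_insert hi, Finset.prod_insert hi, zpow_add₀ hq, ih]

section Factorization

variable {ν : X.Pattern} {q : ℂ} {u : Root N → ℂ} {x : Root N → ℂ → ℂ}

lemma Fplus_eq (hq : q ≠ 0) (v : Root N) (h : x v q = q ^ v.d * xTilde ν q u v) :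
    Fplus ν Root.color x v q = q ^ xiPlus ν v * normFplus ν v q u := by
  unfold Fplus xiPlus normFplus
  rw [Finset.mul_sum, zpow_sum hq, ← Finset.prod_mul_distrib]
  refine Finset.prod_congr rfl fun p _ => ?_
  have hT : (0 : ℤ) ≤ X.tquot v.color := by positivity
  have h1 : x v q * q ^ ((p.2 : ℕ) * X.tquot v.color) - 1 =
      q ^ (X.tquot v.color * min (v.offset + (p.2 : ℕ)) 0) *
        bracket (X.tquot v.color * (v.offset + (p.2 : ℕ))) q (xTilde ν q u v) 1 := by
    have := zpow_mul_sub_zpow_mul hq (X.tquot v.color * (v.offset + (p.2 : ℕ))) 0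
      (xTilde ν q u v) 1
    rw [sub_zero, zpow_zero, mul_one] at this
    rw [mul_min_of_nonneg _ _ hT, mul_zero, ← this, h, mul_right_comm, ← zpow_natCast,
      ← zpow_add₀ hq]
    congr 3
    rw [Root.d]; push_cast; ring
  rw [h1, mul_pow, ← zpow_natCast, ← zpow_natCast, ← zpow_mul]
  congr 2
  ring

lemma Fminus_eq (hq : q ≠ 0) (v : Root N) (h : x v q = q ^ v.d * xTilde ν q u v) :
    Fminus ν Root.color x v q = q ^ xiMinus ν v * normFminus ν v q u := by
  unfold Fminus xiMinus normFminus
  rw [Finset.mul_sum, zpow_sum hq, ← Finset.prod_mul_distrib]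
  refine Finset.prod_congr rfl fun p _ => ?_
  have hT : (0 : ℤ) ≤ X.tquot v.color := by positivity
  have h1 : x v q - q ^ ((p.2 : ℕ) * X.tquot v.color) =
      q ^ (X.tquot v.color * min v.offset (p.2 : ℕ)) *
        bracket (X.tquot v.color * (v.offset - (p.2 : ℕ))) q (xTilde ν q u v) 1 := by
    have := zpow_mul_sub_zpow_mul hq (X.tquot v.color * v.offset) (X.tquot v.color * (p.2 : ℕ))
      (xTilde ν q u v) 1
    rw [mul_one, ← mul_sub] at this
    rw [mul_min_of_nonneg _ _ hT, ← this, h, ← zpow_natCast, Root.d]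
    congr 3
    · ring
    · ring
  rw [h1, mul_pow, ← zpow_natCast, ← zpow_natCast, ← zpow_mul]
  congr 2
  ring

/-- `xTilde` uses natural exponents to be polynomial in `q`; under the order conditions nothing is
lost by the truncation. -/
lemma zpow_zetaOrd_toNat (hN : OrderCondition ν N) (v : Root N) :
    q ^ (zetaOrd ν v.1 v.2).toNat = q ^ zetaOrd ν v.1 v.2 := by
  have h : 0 ≤ zetaOrd ν v.1 v.2 := by
    rcases Nat.eq_zero_or_pos (v.2 : ℕ) with h | h
    · rw [h, zetaOrd_zero]
    · exact (zetaOrd_pos hN v.1 h v.2.isLt).le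
  rw [← zpow_natCast, Int.toNat_of_nonneg h]

lemma IsNext.link_eq {v w : Root N} (h : IsNext v w) : link u w.1 w.2 = u w := by
  have h2 := h.2
  have := w.2.isLt
  rw [link, dif_pos ⟨by omega, this⟩]

lemma IsNext.link_succ_eq {v w : Root N} (h : IsNext v w) : link u v.1 ((v.2 : ℕ) + 1) = u w := by
  rw [← h.link_eq (u := u), ← h.2, h.1]

/-- Each factor gives its superficial power of `q` times a bracket, except that of the predecessor:
there the two powers agree, and the difference of normalized members supplies `q ^ ζ` and the link
coordinate. -/
lemma Gplus_eq (hN : OrderCondition ν N) (hq : q ≠ 0)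
    (h : ∀ v, x v q = q ^ v.d * xTilde ν q u v) (v : Root N) :
    Gplus Root.color x v q =
      q ^ (etaPlus v + zetaOrd ν v.1 v.2) * (link u v.1 v.2 * normGplus ν v q u) := by
  -- The extra factor is moved into the product over roots; for the first member there is no
  -- predecessor, and it is 1 because both `zetaOrd` and `link` are trivial there.
  have hl : q ^ zetaOrd ν v.1 v.2 * link u v.1 v.2 =
      ∏ w : Root N, if IsNext w v then q ^ zetaOrd ν v.1 v.2 * link u v.1 v.2 else 1 := by
    rw [prod_isNext_left]
    split_ifs with hv
    · rfl
    · simp [Nat.eq_zero_of_not_pos hv]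
  rw [zpow_add₀ hq, mul_assoc, ← mul_assoc (q ^ zetaOrd ν v.1 v.2), hl, etaPlus, zpow_sum hq,
    normGplus, ← Finset.prod_mul_distrib, ← Finset.prod_mul_distrib, Gplus]
  refine Finset.prod_congr rfl fun w _ => ?_
  have h1 : x v q * q ^ X.formT v.color w.color - x w q =
      q ^ (v.d + X.formT v.color w.color) * xTilde ν q u v - q ^ w.d * xTilde ν q u w := by
    rw [h, h, zpow_add₀ hq]; ring
  rw [h1]
  split_ifs with hw
  · have hd : v.d + X.formT v.color w.color = w.d := by
      rw [hw.d_eq, hw.color_eq]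
    rw [hd, min_self, ← mul_sub, xTilde_sub ν q u hw, zpow_zetaOrd_toNat hN, hw.link_eq, mul_one]
  · rw [zpow_mul_sub_zpow_mul hq, one_mul]

lemma Gminus_eq (hN : OrderCondition ν N) (hq : q ≠ 0)
    (h : ∀ v, x v q = q ^ v.d * xTilde ν q u v) (v : Root N) :
    Gminus Root.color x v q = q ^ (etaMinus v + zetaOrd ν v.1 ((v.2 : ℕ) + 1)) *
      (nextSign v * link u v.1 ((v.2 : ℕ) + 1) * normGminus ν v q u) := by
  have hl : q ^ zetaOrd ν v.1 ((v.2 : ℕ) + 1) * (nextSign v * link u v.1 ((v.2 : ℕ) + 1)) =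
      ∏ w : Root N, if IsNext v w then q ^ zetaOrd ν v.1 ((v.2 : ℕ) + 1) *
        -link u v.1 ((v.2 : ℕ) + 1) else 1 := by
    rw [prod_isNext_right, nextSign]
    split_ifs with hv
    · ring
    · have : (v.2 : ℕ) + 1 = v.1.len := by have := v.2.isLt; omega
      rw [this]; simp
  rw [zpow_add₀ hq, mul_assoc, ← mul_assoc (q ^ zetaOrd ν v.1 ((v.2 : ℕ) + 1)), hl, etaMinus,
    zpow_sum hq, normGminus, ← Finset.prod_mul_distrib, ← Finset.prod_mul_distrib, Gminus]
  refine Finset.prod_congr rfl fun w _ => ?_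
  have h1 : x v q - x w q * q ^ X.formT v.color w.color =
      q ^ v.d * xTilde ν q u v - q ^ (w.d + X.formT v.color w.color) * xTilde ν q u w := by
    rw [h, h, zpow_add₀ hq]; ring
  rw [h1]
  split_ifs with hw
  · rw [← hw.d_eq, min_self, ← mul_sub, hw.link_succ_eq, mul_one, mul_neg, ← hw.2, hw.1,
      ← zpow_zetaOrd_toNat hN, ← xTilde_sub ν q u hw]
    ring
  · rw [zpow_mul_sub_zpow_mul hq, one_mul]
    congr 2
    ring

end Factorization

/-! ### Leading coefficients at `q = 0` and genericity -/

variable {ν : X.Pattern}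

/-- The inner exponents are positive, so at `q = 0` only the first summand survives: the string
collapses to its center. -/
lemma xTilde_zero (hN : OrderCondition ν N) (u : Root N → ℂ) (v : Root N) :
    xTilde ν 0 u v = u v.1.first := by
  unfold xTilde
  rw [Finset.sum_eq_single (⟨0, v.1.len_pos⟩ : Fin v.1.len)]
  · rw [if_pos (Fin.le_def.2 (Nat.zero_le _))]
    simp [Str.first]
  · intro j _ hj
    have h0 : 0 < (j : ℕ) := Nat.pos_of_ne_zero fun h => hj (Fin.ext h)
    have := zetaOrd_pos hN v.1 h0 j.isLt
    rw [zero_pow (by omega)]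
    simp
  · simp

lemma bracket_ne_zero_iff {e : ℤ} {x y : ℂ} (hx : x ≠ 0) (hy : y ≠ 0) :
    bracket e 0 x y ≠ 0 ↔ (e = 0 → x ≠ y) := by
  rw [bracket_zero_right]
  split_ifs with h1 h2
  · simp [hx, h1.ne]
  · simp [h2, sub_eq_zero]
  · simp [hy, h2]

/-- The factor of the leading coefficient of `F_+ G_-` that depends on the string centers only. -/
def coefPlus (ν : X.Pattern) (z : Str N → ℂ) (v : Root N) : ℂ :=
  (∏ p ∈ ν.support with p.1 = v.color,
    bracket (X.tquot v.color * (v.offset + (p.2 : ℕ))) 0 (z v.1) 1 ^ ν p) *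
  (nextSign v * ∏ w : Root N, if IsNext v w then 1 else
    bracket (v.d - X.formT v.color w.color - w.d) 0 (z v.1) (z w.1))

/-- The factor of the leading coefficient of `F_- G_+` that depends on the string centers only. -/
def coefMinus (ν : X.Pattern) (z : Str N → ℂ) (v : Root N) : ℂ :=
  (∏ p ∈ ν.support with p.1 = v.color,
    bracket (X.tquot v.color * (v.offset - (p.2 : ℕ))) 0 (z v.1) 1 ^ ν p) *
  ∏ w : Root N, if IsNext w v then 1 else
    bracket (v.d + X.formT v.color w.color - w.d) 0 (z v.1) (z w.1)

/-- The normalized `F_+ G_-`. -/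
def normPlus (ν : X.Pattern) (v : Root N) (q : ℂ) (u : Root N → ℂ) : ℂ :=
  normFplus ν v q u * (nextSign v * link u v.1 ((v.2 : ℕ) + 1) * normGminus ν v q u)

/-- The normalized `F_- G_+`. -/
def normMinus (ν : X.Pattern) (v : Root N) (q : ℂ) (u : Root N → ℂ) : ℂ :=
  normFminus ν v q u * (link u v.1 v.2 * normGplus ν v q u)

lemma normPlus_zero (hN : OrderCondition ν N) (v : Root N) (u : Root N → ℂ) :
    normPlus ν v 0 u = coefPlus ν (fun s => u s.first) v * link u v.1 ((v.2 : ℕ) + 1) := by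
  simp only [normPlus, normFplus, normGminus, coefPlus, xTilde_zero hN]
  ring

lemma normMinus_zero (hN : OrderCondition ν N) (v : Root N) (u : Root N → ℂ) :
    normMinus ν v 0 u = coefMinus ν (fun s => u s.first) v * link u v.1 v.2 := by
  simp only [normMinus, normFminus, normGplus, coefMinus, xTilde_zero hN]
  ring

/-- The origin of the parity condition in the genericity of SCE solutions: a bracket of `F_-` is a
difference `z - 1` at `q = 0` only when some offset equals `k`. -/
lemma exists_offset_eq_iff (s : Str N) {k : ℕ} (hk : 0 < k) :
    (∃ i : Fin s.len, Root.offset (⟨s, i⟩ : Root N) = k) ↔ k < s.len ∧ ¬ k ≡ s.len [MOD 2] := by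
  simp only [Root.offset_eq, Nat.ModEq]
  constructor
  · rintro ⟨i, hi⟩
    omega
  · rintro ⟨h1, h2⟩
    exact ⟨⟨(s.len - 1 - k) / 2, by omega⟩, by simp only; omega⟩

/-- Within one string only neighbours have coinciding orders, and these are excluded from the
normalized products. So same-string brackets never vanish at `q = 0`. -/
lemma isNext_of_d_eq {v w : Root N} (hs : v.1 = w.1) (h : v.d + X.formT v.color w.color = w.d) :
    IsNext w v := by
  obtain ⟨s, i⟩ := v
  obtain ⟨s', j⟩ := w
  obtain rfl : s = s' := hs
  refine ⟨rfl, ?_⟩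
  have hq : (X.tquot s.color : ℤ) ≠ 0 := by exact_mod_cast (X.tquot_pos s.color).ne'
  simp only [Root.d, Root.offset, Root.color, formT, cartan, if_true] at h ⊢
  have : (X.tquot s.color : ℤ) * (2 * ((j : ℕ) + 1 - (i : ℕ) : ℤ)) = 0 := by linear_combination h
  rcases mul_eq_zero.1 this with h | h
  · exact absurd h hq
  · omega

lemma tquot_mul_eq_zero_iff (a : X.Color) (e : ℤ) : (X.tquot a : ℤ) * e = 0 ↔ e = 0 := by
  rw [mul_eq_zero, or_iff_right (by exact_mod_cast (X.tquot_pos a).ne')]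

lemma coefMinus_ne_zero_iff {z : Str N → ℂ} (hz : ∀ s, z s ≠ 0) (v : Root N) :
    coefMinus ν z v ≠ 0 ↔
      (∀ p ∈ ν.support, p.1 = v.color → v.offset = (p.2 : ℕ) → z v.1 ≠ 1) ∧
      ∀ w : Root N, v.1 ≠ w.1 → v.d + X.formT v.color w.color = w.d → z v.1 ≠ z w.1 := by
  rw [coefMinus, mul_ne_zero_iff, Finset.prod_ne_zero_iff, Finset.prod_ne_zero_iff]
  refine and_congr ⟨fun h p hp hpv => ?_, fun h p hp => ?_⟩ ⟨fun h w hvw => ?_, fun h w _ => ?_⟩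
  · have := h p (Finset.mem_filter.2 ⟨hp, hpv⟩)
    rw [pow_ne_zero_iff (Finsupp.mem_support_iff.1 hp),
      bracket_ne_zero_iff (hz _) one_ne_zero, tquot_mul_eq_zero_iff, sub_eq_zero] at this
    exact this
  · obtain ⟨hp, hpv⟩ := Finset.mem_filter.1 hp
    rw [pow_ne_zero_iff (Finsupp.mem_support_iff.1 hp),
      bracket_ne_zero_iff (hz _) one_ne_zero, tquot_mul_eq_zero_iff, sub_eq_zero]
    exact h p hp hpv
  · have := h w (Finset.mem_univ w)
    rw [if_neg (fun hn => hvw hn.1.symm), bracket_ne_zero_iff (hz _) (hz _), sub_eq_zero] at this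
    exact this
  · split_ifs with hn
    · exact one_ne_zero
    · rw [bracket_ne_zero_iff (hz _) (hz _), sub_eq_zero]
      exact fun hd => h w (fun hs => hn (isNext_of_d_eq hs hd)) hd

/-- Stated at the reflected roots so that, over all roots together, it repeats the conditions for
`coefMinus`. -/
lemma coefPlus_ne_zero_iff {z : Str N → ℂ} (hz : ∀ s, z s ≠ 0) (v : Root N) :
    coefPlus ν z v ≠ 0 ↔
      (∀ p ∈ ν.support, p.1 = v.color → v.rev.offset = (p.2 : ℕ) → z v.1 ≠ 1) ∧
      ∀ w : Root N, v.1 ≠ w.1 → v.rev.d + X.formT v.color w.color = w.rev.d → z v.1 ≠ z w.1 := by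
  rw [coefPlus, mul_ne_zero_iff, mul_ne_zero_iff, Finset.prod_ne_zero_iff, Finset.prod_ne_zero_iff,
    and_iff_right (nextSign_ne_zero v)]
  refine and_congr ⟨fun h p hp hpv => ?_, fun h p hp => ?_⟩ ⟨fun h w hvw => ?_, fun h w _ => ?_⟩
  · have := h p (Finset.mem_filter.2 ⟨hp, hpv⟩)
    rw [pow_ne_zero_iff (Finsupp.mem_support_iff.1 hp),
      bracket_ne_zero_iff (hz _) one_ne_zero, tquot_mul_eq_zero_iff] at this
    rw [Root.offset_rev]
    exact fun h => this (by omega)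
  · obtain ⟨hp, hpv⟩ := Finset.mem_filter.1 hp
    rw [pow_ne_zero_iff (Finsupp.mem_support_iff.1 hp),
      bracket_ne_zero_iff (hz _) one_ne_zero, tquot_mul_eq_zero_iff]
    have := h p hp hpv
    rw [Root.offset_rev] at this
    exact fun h => this (by omega)
  · have := h w (Finset.mem_univ w)
    rw [if_neg (fun hn => hvw hn.1), bracket_ne_zero_iff (hz _) (hz _)] at this
    rw [Root.d_rev, Root.d_rev]
    exact fun h => this (by omega)
  · split_ifs with hn
    · exact one_ne_zero
    · rw [bracket_ne_zero_iff (hz _) (hz _)]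
      have hw := h w
      rw [Root.d_rev, Root.d_rev] at hw
      refine fun hd => hw (fun hs => hn (isNext_of_d_eq hs.symm ?_)) (by omega)
      have hc : v.color = w.color := by unfold Root.color; rw [hs]
      rw [hc] at hd ⊢
      omega

lemma coef_ne_zero_iff {z : Str N → ℂ} (hz : ∀ s, z s ≠ 0) :
    (∀ v, coefPlus ν z v ≠ 0 ∧ coefMinus ν z v ≠ 0) ↔
      (∀ s : Str N, ∏ p ∈ ν.support with
        p.1 = s.color ∧ (p.2 : ℕ) < s.len ∧ ¬ (p.2 : ℕ) ≡ s.len [MOD 2], (z s - 1) ^ ν p ≠ 0) ∧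
      ∀ s : Str N, ∏ s' : Str N with s' ≠ s, (z s - z s') ^ coincidence s s' ≠ 0 := by
  have h1 : (∀ v, coefPlus ν z v ≠ 0 ∧ coefMinus ν z v ≠ 0) ↔ ∀ v : Root N,
      (∀ p ∈ ν.support, p.1 = v.color → v.offset = (p.2 : ℕ) → z v.1 ≠ 1) ∧
      ∀ w : Root N, v.1 ≠ w.1 → v.d + X.formT v.color w.color = w.d → z v.1 ≠ z w.1 := by
    simp only [coefMinus_ne_zero_iff hz, coefPlus_ne_zero_iff hz]
    refine ⟨fun h v => (h v).2, fun h v => ⟨⟨?_, fun w => ?_⟩, h v⟩⟩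
    · exact (h v.rev).1
    · exact (h v.rev).2 w.rev
  rw [h1, forall_and]
  refine and_congr ⟨fun h s => ?_, fun h v p hp hpv ho => ?_⟩
    ⟨fun h s => ?_, fun h v w hvw hd => ?_⟩
  · refine Finset.prod_ne_zero_iff.2 fun p hp => ?_
    obtain ⟨hp, hps, hlt, hmod⟩ := Finset.mem_filter.1 hp
    obtain ⟨i, hi⟩ := (exists_offset_eq_iff s p.2.pos).2 ⟨hlt, hmod⟩
    exact pow_ne_zero _ (sub_ne_zero.2 (h ⟨s, i⟩ p hp hps hi))
  · have hc := (exists_offset_eq_iff v.1 p.2.pos).1 ⟨v.2, ho⟩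
    have := Finset.prod_ne_zero_iff.1 (h v.1) p (Finset.mem_filter.2 ⟨hp, hpv, hc⟩)
    rw [pow_ne_zero_iff (Finsupp.mem_support_iff.1 hp)] at this
    exact sub_ne_zero.1 this
  · refine Finset.prod_ne_zero_iff.2 fun s' hs' => ?_
    have hne := (Finset.mem_filter.1 hs').2
    by_cases hc : coincidence s s' = 0
    · rw [hc, pow_zero]; exact one_ne_zero
    · obtain ⟨ij⟩ := Fintype.card_pos_iff.1 (Nat.pos_of_ne_zero hc)
      exact pow_ne_zero _ (sub_ne_zero.2 (h ⟨s, ij.1.1⟩ ⟨s', ij.1.2⟩ hne.symm ij.2))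
  · have := Finset.prod_ne_zero_iff.1 (h v.1) w.1
      (Finset.mem_filter.2 ⟨Finset.mem_univ _, hvw.symm⟩)
    have hc : coincidence v.1 w.1 ≠ 0 :=
      (Fintype.card_pos_iff.2 ⟨⟨(v.2, w.2), hd⟩⟩ : 0 < coincidence v.1 w.1).ne'
    rw [pow_ne_zero_iff hc] at this
    exact sub_ne_zero.1 this

/-! ### Reflection of strings and the string center equation -/

/-- At `q = 0` a bracket is `x`, `x - y` or `-y` according to the sign of `e`, so reversing the sign
costs one power of `x / -y`. Products over strings thus reduce to sums of signs. -/
lemma bracket_eq_mul_bracket_neg (e : ℤ) {x y : ℂ} (hx : x ≠ 0) (hy : y ≠ 0) :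
    bracket e 0 x y = (x / -y) ^ (-Int.sign e) * bracket (-e) 0 x y := by
  rw [bracket_zero_right, bracket_zero_right]
  rcases lt_trichotomy e 0 with h | h | h
  · have h' : ¬ -e < 0 := by omega
    simp only [h, h', if_true, if_false, Int.sign_eq_neg_one_of_neg h, neg_eq_zero, h.ne, neg_neg,
      zpow_one]
    field_simp
  · simp [h]
  · have h' : -e < 0 := by omega
    simp only [h.not_gt, h', if_true, if_false, Int.sign_eq_one_of_pos h, h.ne', zpow_neg, zpow_one]
    field_simp

/-- Reflection of all strings. -/
def revEquiv : Root N ≃ Root N := ⟨Root.rev, Root.rev, Root.rev_rev, Root.rev_rev⟩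

lemma isNext_rev_iff (v w : Root N) : IsNext v.rev w.rev ↔ IsNext w v := by
  have hv := v.2.isLt
  have hw := w.2.isLt
  have key : v.1 = w.1 → (((w.rev.2 : ℕ) = v.rev.2 + 1) ↔ (v.2 : ℕ) = w.2 + 1) := by
    intro h
    have hl : v.1.len = w.1.len := by rw [h]
    simp only [Root.rev, Fin.val_rev]
    omega
  constructor
  · rintro ⟨h1, h2⟩
    exact ⟨h1.symm, (key h1).1 h2⟩
  · rintro ⟨h1, h2⟩
    exact ⟨h1.symm, (key h1.symm).2 h2⟩

lemma prod_fin_rev {m : ℕ} (g : Fin m → ℂ) : ∏ i, g (Fin.rev i) = ∏ i, g i :=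
  Equiv.prod_comp Fin.revPerm g

lemma prod_nextSign (s : Str N) :
    ∏ i : Fin s.len, nextSign (⟨s, i⟩ : Root N) = (-1) ^ (s.len + 1) := by
  obtain ⟨m, hm⟩ : ∃ m, s.len = m + 1 := ⟨s.len - 1, by have := s.len_pos; omega⟩
  simp only [nextSign]
  rw [Fin.prod_univ_eq_prod_range (fun i => if i + 1 < s.len then (-1 : ℂ) else 1) s.len, hm,
    Finset.prod_range_succ, Finset.prod_congr rfl (g := fun _ => (-1 : ℂ))]
  · simp [pow_succ]
  · intro i hi
    rw [Finset.mem_range] at hi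
    rw [if_pos (by omega)]

/-- Reflecting the string turns the exponents of `F_+` into minus those of `F_-`; the accumulated
power is minus the sign sum `offsetSum_sign_add`, weighted by `ν`. -/
lemma prod_bracket_F {z : ℂ} (hz : z ≠ 0) (s : Str N) :
    ∏ i : Fin s.len, ∏ p ∈ ν.support with p.1 = s.color,
      bracket (X.tquot s.color * (Root.offset (⟨s, i⟩ : Root N) + (p.2 : ℕ))) 0 z 1 ^ ν p =
    (-z) ^ (-gamma ν s.color s.len) * ∏ i : Fin s.len, ∏ p ∈ ν.support with p.1 = s.color,
      bracket (X.tquot s.color * (Root.offset (⟨s, i⟩ : Root N) - (p.2 : ℕ))) 0 z 1 ^ ν p := by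
  have hz' : -z ≠ 0 := neg_ne_zero.2 hz
  rw [← prod_fin_rev (fun i : Fin s.len => ∏ p ∈ ν.support with p.1 = s.color,
      bracket (X.tquot s.color * (Root.offset (⟨s, i⟩ : Root N) - (p.2 : ℕ))) 0 z 1 ^ ν p)]
  have h : ∀ (i : Fin s.len) (p : X.H),
      bracket (X.tquot s.color * (Root.offset (⟨s, i⟩ : Root N) + (p.2 : ℕ))) 0 z 1 ^ ν p =
      (-z) ^ (-(Int.sign (Root.offset (⟨s, i⟩ : Root N) + (p.2 : ℕ)) * ν p)) *
        bracket (X.tquot s.color * (Root.offset (⟨s, Fin.rev i⟩ : Root N) - (p.2 : ℕ))) 0 z 1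
          ^ ν p := by
    intro i p
    have hs : Int.sign (X.tquot s.color : ℤ) = 1 :=
      Int.sign_eq_one_of_pos (by exact_mod_cast X.tquot_pos s.color)
    rw [bracket_eq_mul_bracket_neg _ hz one_ne_zero, mul_pow, Int.sign_mul, hs, one_mul,
      ← zpow_natCast, ← zpow_mul, neg_mul, div_neg, div_one]
    congr 3
    have := Root.offset_rev (⟨s, i⟩ : Root N)
    rw [show (⟨s, Fin.rev i⟩ : Root N) = Root.rev ⟨s, i⟩ from rfl, this]
    ring
  simp only [h, Finset.prod_mul_distrib]
  congr 1
  simp only [← zpow_sum hz']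
  congr 1
  rw [Finset.sum_comm, gamma, ← Finset.sum_neg_distrib]
  refine Finset.sum_congr rfl fun p _ => ?_
  rw [Finset.sum_neg_distrib, ← Finset.sum_mul, sum_root s (fun o => Int.sign (o + (p.2 : ℕ))),
    offsetSum_sign_add]

/-- The part of the matrix of the string center equation that does not involve
`P_m^{(a)} + N_m^{(a)}`. -/
def matE (s s' : Str N) : ℤ :=
  X.formMin s.color s.len s'.color s'.len - if s.1 = s'.1 then 1 else 0

lemma fst_eq_iff (s s' : Str N) : s.1 = s'.1 ↔ s.color = s'.color ∧ s.len = s'.len := by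
  rw [Subtype.ext_iff, Prod.ext_iff]
  simp only [Str.color, Str.len, PNat.coe_inj]

/-- Reflecting both strings exchanges the normalized `G_-` and `G_+`; the sign sums over pairs of
members add up to `matE`. -/
lemma prod_bracket_G {z : Str N → ℂ} (hz : ∀ s, z s ≠ 0) (s : Str N) :
    ∏ i : Fin s.len, ∏ w : Root N, (if IsNext ⟨s, i⟩ w then 1 else
      bracket (Root.d (⟨s, i⟩ : Root N) - X.formT s.color w.color - w.d) 0 (z s) (z w.1)) =
    (∏ s' : Str N, (z s / -z s') ^ matE s s') *
      ∏ i : Fin s.len, ∏ w : Root N, (if IsNext w ⟨s, i⟩ then 1 else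
        bracket (Root.d (⟨s, i⟩ : Root N) + X.formT s.color w.color - w.d) 0 (z s) (z w.1)) := by
  have h : ∀ (i : Fin s.len) (w : Root N), (if IsNext ⟨s, i⟩ w then 1 else
      bracket (Root.d (⟨s, i⟩ : Root N) - X.formT s.color w.color - w.d) 0 (z s) (z w.1)) =
      (z s / -z w.1) ^ (-Int.sign (X.tquot s.color * Root.offset (⟨s, i⟩ : Root N) -
        X.tquot w.color * w.offset - X.formT s.color w.color)) *
      (if IsNext w.rev ⟨s, Fin.rev i⟩ then 1 else
        bracket (Root.d (⟨s, Fin.rev i⟩ : Root N) + X.formT s.color w.rev.color - w.rev.d) 0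
          (z s) (z w.rev.1)) := by
    intro i w
    have e : X.tquot s.color * Root.offset (⟨s, i⟩ : Root N) -
        X.tquot w.color * w.offset - X.formT s.color w.color =
        Root.d (⟨s, i⟩ : Root N) - X.formT s.color w.color - w.d := by
      simp only [Root.d, Root.color]; ring
    rw [e, show (⟨s, Fin.rev i⟩ : Root N) = Root.rev ⟨s, i⟩ from rfl]
    simp only [isNext_rev_iff]
    split_ifs with hn
    -- An excluded neighbour has exponent `e = 0`, hence sign 0, so the sum of signs may run over
    -- all pairs.
    · have := hn.d_eq
      rw [show Root.d (⟨s, i⟩ : Root N) - X.formT s.color w.color - w.d = 0 by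
        rw [this]; simp only [Root.color]; ring]
      simp
    · rw [bracket_eq_mul_bracket_neg _ (hz _) (hz _), Root.color_rev, Root.d_rev, Root.d_rev]
      congr 2
      · ring
  simp only [h, Finset.prod_mul_distrib]
  congr 1
  · have h2 : ∀ s' : Str N, (z s / -z s') ^ matE s s' = ∏ i : Fin s.len, ∏ j : Fin s'.len,
        (z s / -z s') ^ (-Int.sign (X.tquot s.color * Root.offset (⟨s, i⟩ : Root N) -
        X.tquot s'.color * Root.offset (⟨s', j⟩ : Root N) - X.formT s.color s'.color)) := by
      intro s'
      have hne : z s / -z s' ≠ 0 := div_ne_zero (hz _) (neg_ne_zero.2 (hz _))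
      simp only [← zpow_sum hne]
      congr 1
      simp only [Finset.sum_neg_distrib]
      have h3 : ∀ i : Fin s.len, ∑ j : Fin s'.len,
          Int.sign (X.tquot s.color * Root.offset (⟨s, i⟩ : Root N) -
            X.tquot s'.color * Root.offset (⟨s', j⟩ : Root N) - X.formT s.color s'.color) =
          offsetSum s'.len (fun o' => Int.sign (X.tquot s.color * Root.offset (⟨s, i⟩ : Root N) -
            X.tquot s'.color * o' - X.formT s.color s'.color)) := fun i => by
        rw [← sum_root]
      simp only [h3]
      rw [sum_root s (fun o => offsetSum s'.len (fun o' => Int.sign (X.tquot s.color * o -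
            X.tquot s'.color * o' - X.formT s.color s'.color))),
        offsetSum_offsetSum_sign_eq_formMin, matE]
      simp only [fst_eq_iff, s'.len_pos, and_true]
      ring
    simp only [h2]
    refine Eq.trans ?_ Finset.prod_comm
    refine Finset.prod_congr rfl fun i _ => ?_
    exact Fintype.prod_sigma (fun w : Root N =>
      (z s / -z w.1) ^ (-Int.sign (X.tquot s.color * Root.offset (⟨s, i⟩ : Root N) -
        X.tquot w.color * w.offset - X.formT s.color w.color)))
  · rw [← prod_fin_rev (fun i : Fin s.len => ∏ w : Root N, (if IsNext w ⟨s, i⟩ then 1 else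
        bracket (Root.d (⟨s, i⟩ : Root N) + X.formT s.color w.color - w.d) 0 (z s) (z w.1)))]
    refine Finset.prod_congr rfl fun i _ => ?_
    exact Equiv.prod_comp revEquiv (fun w : Root N => (if IsNext w ⟨s, Fin.rev i⟩ then 1 else
        bracket (Root.d (⟨s, Fin.rev i⟩ : Root N) + X.formT s.color w.color - w.d) 0
          (z s) (z w.1)))

lemma matA_eq (s s' : Str N) : matA ν N s s' =
    (if s = s' then vacancy ν N s.color s.len + (N s.1.1 : ℤ) else 0) + matE s s' := by
  simp only [matA, Matrix.of_apply, matE]; ring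

/-- Row sums collect the powers of `-z s`. With the `-γ` from `F` they leave minus `P + N`, which
the diagonal of `matA` compensates up to sign. -/
lemma sum_matE (s : Str N) : ∑ s' : Str N, matE s s' =
    gamma ν s.color s.len - (vacancy ν N s.color s.len + (N s.1.1 : ℤ)) := by
  have h1 : ∑ s' : Str N, (if s.1 = s'.1 then (1 : ℤ) else 0) = N s.1.1 := by
    simp only [fst_eq_iff]
    rw [← count_eq_sum, count, dif_pos s.len_pos]
    rfl
  simp only [matE, Finset.sum_sub_distrib, h1]
  rw [sum_str (fun b k => X.formMin s.color s.len b k), vacancy]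
  simp only [nsmul_eq_mul, mul_comm]
  ring

/-- The product of the equations of one string at `q = 0` is the string center equation. -/
lemma prod_coefPlus {z : Str N → ℂ} (hz : ∀ s, z s ≠ 0) (s : Str N) :
    (∏ i : Fin s.len, coefPlus ν z ⟨s, i⟩) * ∏ s', z s' ^ matA ν N s s' =
      (-1) ^ s.len * (-1) ^ (vacancy ν N s.color s.len + (N s.1.1 : ℤ) + 1) *
        ∏ i : Fin s.len, coefMinus ν z ⟨s, i⟩ := by
  have hz' : -z s ≠ 0 := neg_ne_zero.2 (hz s)
  have hA : ∏ s', z s' ^ matA ν N s s' =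
      z s ^ (vacancy ν N s.color s.len + (N s.1.1 : ℤ)) * ∏ s', z s' ^ matE s s' := by
    simp only [matA_eq, fun s' (m n : ℤ) => zpow_add₀ (hz s') m n, Finset.prod_mul_distrib]
    rw [← zpow_add₀ (hz s)]
    congr 1
    rw [Finset.prod_eq_single s]
    · simp
    · intro s' _ h
      rw [if_neg h.symm, zpow_zero]
    · simp
  have hE : ∏ s' : Str N, (z s / -z s') ^ matE s s' =
      (-z s) ^ (gamma ν s.color s.len - (vacancy ν N s.color s.len + (N s.1.1 : ℤ))) *
        (∏ s', z s' ^ matE s s')⁻¹ := by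
    rw [← sum_matE, zpow_sum hz', ← Finset.prod_inv_distrib, ← Finset.prod_mul_distrib]
    refine Finset.prod_congr rfl fun s' _ => ?_
    rw [div_neg, ← neg_div, div_zpow, div_eq_mul_inv]
  have hne : ∏ s', z s' ^ matE s s' ≠ 0 :=
    Finset.prod_ne_zero_iff.2 fun s' _ => zpow_ne_zero _ (hz s')
  have hsign : (-z s) ^ (-gamma ν s.color s.len) *
      (-z s) ^ (gamma ν s.color s.len - (vacancy ν N s.color s.len + (N s.1.1 : ℤ))) *
      z s ^ (vacancy ν N s.color s.len + (N s.1.1 : ℤ)) =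
      (-1) ^ (vacancy ν N s.color s.len + (N s.1.1 : ℤ)) := by
    generalize vacancy ν N s.color s.len + (N s.1.1 : ℤ) = c
    rw [← zpow_add₀ hz', ← add_sub_assoc, neg_add_cancel, zero_sub, zpow_neg, ← inv_zpow, ← mul_zpow]
    congr 1
    have := hz s
    field_simp
  have hP : ∏ i : Fin s.len, coefPlus ν z ⟨s, i⟩ =
      (∏ i : Fin s.len, ∏ p ∈ ν.support with p.1 = s.color,
        bracket (X.tquot s.color * (Root.offset (⟨s, i⟩ : Root N) + (p.2 : ℕ))) 0 (z s) 1 ^ ν p) *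
      ((∏ i : Fin s.len, nextSign (⟨s, i⟩ : Root N)) *
        ∏ i : Fin s.len, ∏ w : Root N, (if IsNext ⟨s, i⟩ w then 1 else
        bracket (Root.d (⟨s, i⟩ : Root N) - X.formT s.color w.color - w.d) 0 (z s) (z w.1))) := by
    rw [← Finset.prod_mul_distrib, ← Finset.prod_mul_distrib]
    rfl
  have hM : ∏ i : Fin s.len, coefMinus ν z ⟨s, i⟩ =
      (∏ i : Fin s.len, ∏ p ∈ ν.support with p.1 = s.color,
        bracket (X.tquot s.color * (Root.offset (⟨s, i⟩ : Root N) - (p.2 : ℕ))) 0 (z s) 1 ^ ν p) *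
      ∏ i : Fin s.len, ∏ w : Root N, (if IsNext w ⟨s, i⟩ then 1 else
        bracket (Root.d (⟨s, i⟩ : Root N) + X.formT s.color w.color - w.d) 0 (z s) (z w.1)) := by
    rw [← Finset.prod_mul_distrib]
    rfl
  rw [hP, hM, prod_bracket_F (hz s), prod_bracket_G hz s, prod_nextSign, hA, hE,
    zpow_add₀ (by norm_num) _ 1, ← hsign]
  field_simp
  ring

/-! ### Initial points and generic SCE solutions -/

/-- The string centers of a point of the coordinate space. -/
def centers (u : Root N → ℂ) (s : Str N) : ℂ := u s.first

/-- The values at `q = 0` of the coordinates of generic string solutions. -/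
structure IsInitialPoint (ν : X.Pattern) (u : Root N → ℂ) : Prop where
  ne_zero : ∀ v, u v ≠ 0
  coef_ne_zero : ∀ v, coefPlus ν (centers u) v ≠ 0 ∧ coefMinus ν (centers u) v ≠ 0
  eq_zero : ∀ v : Root N, coefPlus ν (centers u) v * link u v.1 ((v.2 : ℕ) + 1) =
    -(coefMinus ν (centers u) v * link u v.1 v.2)

lemma link_ne_zero {u : Root N → ℂ} (h : ∀ v, u v ≠ 0) (s : Str N) (i : ℕ) : link u s i ≠ 0 := by
  unfold link; split_ifs
  · exact h _
  · exact one_ne_zero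

lemma prod_succ_eq_prod (m : ℕ) (f : ℕ → ℂ) (h0 : f 0 = 1) (hm : f m = 1) :
    ∏ i : Fin m, f (i + 1) = ∏ i : Fin m, f i := by
  rw [Fin.prod_univ_eq_prod_range (fun i => f (i + 1)), Fin.prod_univ_eq_prod_range f]
  have h1 := Finset.prod_range_succ' f m
  rw [Finset.prod_range_succ, h0, hm, mul_one, mul_one] at h1
  exact h1.symm

/-- Along a string the products of next links and of previous links agree, since both end links are
1. What remains is a relation between the coefficients, equivalent by `prod_coefPlus` to the string
center equation. -/
lemma IsInitialPoint.isGenericSCESolution {u : Root N → ℂ} (h : IsInitialPoint ν u) :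
    IsGenericSCESolution ν N (centers u) := by
  have hz : ∀ s, centers u s ≠ 0 := fun s => h.ne_zero _
  obtain ⟨h1, h2⟩ := (coef_ne_zero_iff hz).1 h.coef_ne_zero
  refine ⟨⟨hz, fun s => ?_⟩, h1, h2⟩
  have hP : (∏ i : Fin s.len, coefPlus ν (centers u) ⟨s, i⟩) =
      (-1) ^ s.len * ∏ i : Fin s.len, coefMinus ν (centers u) ⟨s, i⟩ := by
    have hprod := Finset.prod_congr rfl fun (i : Fin s.len) (_ : i ∈ Finset.univ) =>
      h.eq_zero ⟨s, i⟩
    simp only [← neg_one_mul (coefMinus _ _ _ * _)] at hprod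
    rw [Finset.prod_mul_distrib, Finset.prod_mul_distrib, Finset.prod_mul_distrib,
      prod_succ_eq_prod s.len (link u s) (by simp) (by simp), Finset.prod_const, Finset.card_univ,
      Fintype.card_fin, ← mul_assoc] at hprod
    have hl : ∏ i : Fin s.len, link u s i ≠ 0 :=
      Finset.prod_ne_zero_iff.2 fun i _ => link_ne_zero h.ne_zero s i
    exact mul_right_cancel₀ hl hprod
  have hM : ∏ i : Fin s.len, coefMinus ν (centers u) ⟨s, i⟩ ≠ 0 :=
    Finset.prod_ne_zero_iff.2 fun i _ => (h.coef_ne_zero _).2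
  have key := prod_coefPlus (ν := ν) hz s
  rw [hP, mul_right_comm] at key
  exact mul_left_cancel₀ (pow_ne_zero _ (by norm_num)) (mul_right_cancel₀ hM key)

/-- The equations at `q = 0` determine each link from the previous one, because `coefPlus` is
nonzero and depends on the centers only. -/
lemma IsInitialPoint.eq_of_centers_eq {u u' : Root N → ℂ} (h : IsInitialPoint ν u)
    (h' : IsInitialPoint ν u') (hc : centers u = centers u') : u = u' := by
  have key : ∀ (s : Str N) (i : ℕ), i < s.len → link u s i = link u' s i := by
    intro s i
    induction i with
    | zero => simp
    | succ i ih =>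
      intro hi
      have h1 := h.eq_zero ⟨s, ⟨i, by omega⟩⟩
      have h2 := h'.eq_zero ⟨s, ⟨i, by omega⟩⟩
      simp only [← hc] at h2
      rw [← ih (by omega), ← h1] at h2
      exact (mul_left_cancel₀ (h.coef_ne_zero _).1 h2).symm
  funext v
  rcases Nat.eq_zero_or_pos (v.2 : ℕ) with hv | hv
  · have : v = v.1.first := Root.ext' rfl hv
    rw [this]
    exact congrFun hc v.1
  · have := key v.1 v.2 v.2.isLt
    rwa [link, dif_pos ⟨hv, v.2.isLt⟩, link, dif_pos ⟨hv, v.2.isLt⟩] at this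

lemma IsGenericSCESolution.exists_isInitialPoint {z : Str N → ℂ} (h : IsGenericSCESolution ν N z) :
    ∃ u : Root N → ℂ, IsInitialPoint ν u ∧ centers u = z := by
  have hz := h.solution.1
  have hne := (coef_ne_zero_iff hz).2 ⟨h.ne_one, h.ne⟩
  -- The ratio of consecutive links forced by the equation at `q = 0`; the value 1 past the end is
  -- only a nonzero filler.
  let ρ : (s : Str N) → ℕ → ℂ := fun s j =>
    if hj : j < s.len then -coefMinus ν z ⟨s, ⟨j, hj⟩⟩ / coefPlus ν z ⟨s, ⟨j, hj⟩⟩ else 1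
  have hρ : ∀ (s : Str N) (i : Fin s.len), ρ s i = -coefMinus ν z ⟨s, i⟩ / coefPlus ν z ⟨s, i⟩ :=
    fun s i => dif_pos i.isLt
  have hρ0 : ∀ s j, ρ s j ≠ 0 := by
    intro s j
    simp only [ρ]
    split_ifs with hj
    · exact div_ne_zero (neg_ne_zero.2 (hne _).2) (hne _).1
    · exact one_ne_zero
  let l : Str N → ℕ → ℂ := fun s i => ∏ j ∈ Finset.range i, ρ s j
  have hl0 : ∀ s i, l s i ≠ 0 := fun s i => Finset.prod_ne_zero_iff.2 fun j _ => hρ0 s j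
  -- The links built from the left must close up at the right end; this is where the string center
  -- equation is used.
  have hllen : ∀ s, l s s.len = 1 := by
    intro s
    have h1 : l s s.len = ∏ i : Fin s.len, ρ s i := (Fin.prod_univ_eq_prod_range (ρ s) s.len).symm
    have key := prod_coefPlus (ν := ν) hz s
    rw [h.solution.2 s, mul_right_comm] at key
    have key := mul_right_cancel₀ (zpow_ne_zero _ (by norm_num)) key
    rw [h1]
    simp only [hρ, ← neg_one_mul (coefMinus _ _ _)]
    rw [Finset.prod_div_distrib, Finset.prod_mul_distrib, Finset.prod_const, Finset.card_univ,
      Fintype.card_fin, ← key, div_self]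
    exact Finset.prod_ne_zero_iff.2 fun i _ => (hne _).1
  let u : Root N → ℂ := fun v => if (v.2 : ℕ) = 0 then z v.1 else l v.1 v.2
  have hc : centers u = z := by
    funext s
    simp [centers, u, Str.first]
  have hlink : ∀ s i, i ≤ s.len → link u s i = l s i := by
    intro s i hi
    unfold link
    split_ifs with h2
    · simp only [u, h2.1.ne', if_false]
    · rcases Nat.eq_zero_or_pos i with rfl | hpos
      · simp [l]
      · rw [show i = s.len by omega, hllen]
  refine ⟨u, ⟨fun v => ?_, by rwa [hc], fun v => ?_⟩, hc⟩
  · simp only [u]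
    split_ifs
    · exact hz _
    · exact hl0 _ _
  · rw [hlink _ _ v.2.isLt, hlink _ _ v.2.isLt.le, hc]
    simp only [l]
    rw [Finset.prod_range_succ, hρ]
    have := (hne v).1
    field_simp

/-! ### The Jacobian at `q = 0` -/

lemma differentiable_coefPlus (z w : Str N → ℂ) (v : Root N) :
    Differentiable ℂ (fun τ : ℂ => coefPlus ν (fun s => z s + τ * w s) v) := by
  unfold coefPlus bracket
  refine .mul ?_ (.const_mul ?_ _)
  · fun_prop
  · refine Differentiable.fun_finsetProd fun w _ => ?_
    split_ifs <;> fun_prop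

lemma differentiable_coefMinus (z w : Str N → ℂ) (v : Root N) :
    Differentiable ℂ (fun τ : ℂ => coefMinus ν (fun s => z s + τ * w s) v) := by
  unfold coefMinus bracket
  refine .mul ?_ ?_
  · fun_prop
  · refine Differentiable.fun_finsetProd fun w _ => ?_
    split_ifs <;> fun_prop

lemma differentiable_link (u w : Root N → ℂ) (s : Str N) (i : ℕ) :
    Differentiable ℂ (fun τ : ℂ => link (fun v => u v + τ * w v) s i) := by
  unfold link
  split_ifs <;> fun_prop

lemma logDeriv_add_mul (a b : ℂ) : logDeriv (fun τ : ℂ => a + τ * b) 0 = b / a := by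
  have : HasDerivAt (fun τ : ℂ => a + τ * b) b 0 := by
    simpa using ((hasDerivAt_id (0 : ℂ)).mul_const b).const_add a
  rw [logDeriv_apply, this.deriv]
  simp

lemma matA_mulVec_injective (hA : (matA ν N).det ≠ 0) {y : Str N → ℂ}
    (h : ∀ s, ∑ s', (matA ν N s s' : ℂ) * y s' = 0) : y = 0 := by
  have hdet : ((matA ν N).map (Int.cast : ℤ → ℂ)).det ≠ 0 := by
    have := (Int.castRingHom ℂ).map_det (matA ν N)
    simp only [RingHom.mapMatrix_apply, Int.coe_castRingHom] at this
    rw [← this]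
    exact_mod_cast hA
  exact Matrix.eq_zero_of_mulVec_eq_zero hdet (funext h)

/-- The Jacobian of the system at `q = 0` is injective. -/
lemma IsInitialPoint.tangent_eq_zero (hA : (matA ν N).det ≠ 0) {u : Root N → ℂ}
    (h : IsInitialPoint ν u) {w : Root N → ℂ}
    (hw : ∀ v : Root N, deriv (fun τ : ℂ =>
      coefPlus ν (centers fun v => u v + τ * w v) v *
          link (fun v => u v + τ * w v) v.1 ((v.2 : ℕ) + 1) +
        coefMinus ν (centers fun v => u v + τ * w v) v * link (fun v => u v + τ * w v) v.1 v.2)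
      0 = 0) : w = 0 := by
  let p : Root N → ℂ → ℂ := fun v τ => coefPlus ν (centers fun v => u v + τ * w v) v
  let m : Root N → ℂ → ℂ := fun v τ => coefMinus ν (centers fun v => u v + τ * w v) v
  let l : Str N → ℕ → ℂ → ℂ := fun s i τ => link (fun v => u v + τ * w v) s i
  have hp : ∀ v, Differentiable ℂ (p v) := differentiable_coefPlus (centers u) (centers w)
  have hm : ∀ v, Differentiable ℂ (m v) := differentiable_coefMinus (centers u) (centers w)
  have hl : ∀ s i, Differentiable ℂ (l s i) := differentiable_link u w
  have hu0 : (fun v => u v + 0 * w v) = u := by simp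
  have hp0 : ∀ v, p v 0 ≠ 0 := fun v => by
    simp only [p, hu0]; exact (h.coef_ne_zero v).1
  have hm0 : ∀ v, m v 0 ≠ 0 := fun v => by
    simp only [m, hu0]; exact (h.coef_ne_zero v).2
  have hl0 : ∀ s i, l s i 0 ≠ 0 := fun s i => by
    simp only [l, hu0]; exact link_ne_zero h.ne_zero s i
  -- Division of the differentiated equation by the equation itself makes it additive in
  -- coefficients and links.
  have hrel : ∀ v : Root N, logDeriv (p v) 0 + logDeriv (l v.1 ((v.2 : ℕ) + 1)) 0 =
      logDeriv (m v) 0 + logDeriv (l v.1 v.2) 0 := by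
    intro v
    have h1 : deriv (p v * l v.1 ((v.2 : ℕ) + 1)) 0 + deriv (m v * l v.1 v.2) 0 = 0 := by
      rw [← deriv_add ((hp v).mul (hl _ _) 0) ((hm v).mul (hl _ _) 0)]
      exact hw v
    have h2 : (p v * l v.1 ((v.2 : ℕ) + 1)) 0 = -(m v * l v.1 v.2) 0 := by
      simp only [Pi.mul_apply, p, m, l, hu0]
      exact h.eq_zero v
    rw [← logDeriv_mul _ (hp0 v) (hl0 _ _) (hp v 0) (hl _ _ 0),
      ← logDeriv_mul _ (hm0 v) (hl0 _ _) (hm v 0) (hl _ _ 0)]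
    change logDeriv (p v * l v.1 ((v.2 : ℕ) + 1)) 0 = logDeriv (m v * l v.1 v.2) 0
    rw [logDeriv_apply, logDeriv_apply, h2, eq_neg_of_add_eq_zero_left h1, neg_div_neg_eq]
  have hlz : ∀ s, logDeriv (l s 0) 0 = 0 := fun s => by
    have : l s 0 = fun _ => 1 := by funext τ; simp [l]
    rw [this, logDeriv_const]; rfl
  have hll : ∀ s, logDeriv (l s s.len) 0 = 0 := fun s => by
    have : l s s.len = fun _ => 1 := by funext τ; simp [l]
    rw [this, logDeriv_const]; rfl
  -- The logarithmic derivatives of the links telescope between the two ends, where the links are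
  -- constant.
  have hsum : ∀ s : Str N, ∑ i : Fin s.len, logDeriv (p ⟨s, i⟩) 0 =
      ∑ i : Fin s.len, logDeriv (m ⟨s, i⟩) 0 := by
    intro s
    have h1 : ∑ i : Fin s.len, (logDeriv (l s ((i : ℕ) + 1)) 0 - logDeriv (l s i) 0) = 0 := by
      rw [Fin.sum_univ_eq_sum_range (fun i => logDeriv (l s (i + 1)) 0 - logDeriv (l s i) 0),
        Finset.sum_range_sub (fun i => logDeriv (l s i) 0), hll, hlz, sub_zero]
    rw [← sub_eq_zero, ← Finset.sum_sub_distrib, ← neg_eq_zero, ← Finset.sum_neg_distrib]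
    refine Eq.trans ?_ h1
    refine Finset.sum_congr rfl fun i _ => ?_
    have := hrel ⟨s, i⟩
    simp only at this
    linear_combination -this
  have hcz : ∀ s, centers u s ≠ 0 := fun s => h.ne_zero _
  have hlin : ∀ s : Str N, ∑ s', (matA ν N s s' : ℂ) * (centers w s' / centers u s') = 0 := by
    intro s
    let c : ℂ := (-1) ^ s.len * (-1) ^ (vacancy ν N s.color s.len + (N s.1.1 : ℤ) + 1)
    have hc : c ≠ 0 := mul_ne_zero (pow_ne_zero _ (by norm_num)) (zpow_ne_zero _ (by norm_num))
    let ζ : Str N → ℂ → ℂ := fun s' τ => (centers u s' + τ * centers w s') ^ matA ν N s s'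
    have hζ : ∀ s', DifferentiableAt ℂ (fun τ : ℂ => centers u s' + τ * centers w s') 0 :=
      fun s' => by fun_prop
    have hζ0 : ∀ s', ζ s' 0 ≠ 0 := fun s' => zpow_ne_zero _ (by simpa using hcz s')
    have hζd : ∀ s', DifferentiableAt ℂ (ζ s') 0 :=
      fun s' => (hζ s').zpow (Or.inl (by simpa using hcz s'))
    -- `prod_coefPlus` holds for all nonzero centers, not only solutions, so it can be
    -- differentiated along the tangent line. By `hsum` the coefficients drop out and a row of
    -- `matA` remains.
    have hev : (fun τ => (∏ i : Fin s.len, p ⟨s, i⟩ τ) * ∏ s', ζ s' τ) =ᶠ[𝓝 0]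
        fun τ => c * ∏ i : Fin s.len, m ⟨s, i⟩ τ := by
      have hne : ∀ᶠ τ in 𝓝 (0 : ℂ), ∀ s', centers u s' + τ * centers w s' ≠ 0 :=
        eventually_all.2 fun s' => (hζ s').continuousAt.eventually_ne (by simpa using hcz s')
      filter_upwards [hne] with τ hτ
      exact prod_coefPlus (z := fun s' => centers u s' + τ * centers w s') hτ s
    have key := (logDeriv_congr_nhds hev).eq_of_nhds
    rw [logDeriv_const_mul 0 c hc, logDeriv_mul, logDeriv_prod, logDeriv_prod, logDeriv_prod, hsum,
      add_eq_left] at key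
    · rw [← key]
      refine Finset.sum_congr rfl fun s' _ => ?_
      simp only [ζ]
      rw [logDeriv_fun_zpow (hζ s'), logDeriv_add_mul]
    · exact fun i _ => hm0 _
    · exact fun i _ => hm _ 0
    · exact fun i _ => hζ0 _
    · exact fun i _ => hζd _
    · exact fun i _ => hp0 _
    · exact fun i _ => hp _ 0
    · exact Finset.prod_ne_zero_iff.2 fun i _ => hp0 _
    · exact Finset.prod_ne_zero_iff.2 fun i _ => hζ0 _
    · exact .fun_finsetProd fun i _ => hp _ 0
    · exact .fun_finsetProd fun i _ => hζd _
  have hcw : ∀ s, centers w s = 0 := fun s => by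
    have := congrFun (matA_mulVec_injective hA hlin) s
    simpa [hcz s] using this
  have hcc : ∀ τ : ℂ, (centers fun v => u v + τ * w v) = centers u := fun τ => by
    funext s
    have := hcw s
    simp only [centers] at this ⊢
    rw [this]; ring
  -- With the centers fixed the coefficients are constant, so vanishing propagates from the left end
  -- along the links.
  have hrel' : ∀ v : Root N, logDeriv (l v.1 ((v.2 : ℕ) + 1)) 0 = logDeriv (l v.1 v.2) 0 := by
    intro v
    have h1 : logDeriv (p v) 0 = 0 := by simp only [p, hcc]; rw [logDeriv_const]; rfl
    have h2 : logDeriv (m v) 0 = 0 := by simp only [m, hcc]; rw [logDeriv_const]; rfl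
    simpa [h1, h2] using hrel v
  have hl_zero : ∀ (s : Str N) (i : ℕ), i < s.len → logDeriv (l s i) 0 = 0 := by
    intro s i
    induction i with
    | zero => exact fun _ => hlz s
    | succ i ih => exact fun hi => (hrel' ⟨s, ⟨i, by omega⟩⟩).trans (ih (by omega))
  funext v
  rcases Nat.eq_zero_or_pos (v.2 : ℕ) with hv | hv
  · have : v = v.1.first := Root.ext' rfl hv
    rw [this]
    exact hcw v.1
  · have h1 : l v.1 v.2 = fun τ => u v + τ * w v := by
      funext τ
      simp only [l, link]
      rw [dif_pos ⟨hv, v.2.isLt⟩]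
    have := hl_zero v.1 v.2 v.2.isLt
    rw [h1, logDeriv_add_mul] at this
    simpa [h.ne_zero v] using this

/-! ### The analytic system and the implicit function theorem -/

open scoped ContDiff

lemma contDiff_xTilde (v : Root N) :
    ContDiff ℂ ω (fun y : ℂ × (Root N → ℂ) => xTilde ν y.1 y.2 v) := by
  unfold xTilde
  refine ContDiff.sum fun j _ => ?_
  split_ifs <;> fun_prop

lemma contDiff_bracket {E : Type*} [NormedAddCommGroup E] [NormedSpace ℂ E] {f g h : E → ℂ} (e : ℤ)
    (hf : ContDiff ℂ ω f) (hg : ContDiff ℂ ω g) (hh : ContDiff ℂ ω h) :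
    ContDiff ℂ ω (fun y => bracket e (f y) (g y) (h y)) := by
  unfold bracket; fun_prop

lemma contDiff_link (s : Str N) (i : ℕ) :
    ContDiff ℂ ω (fun y : ℂ × (Root N → ℂ) => link y.2 s i) := by
  unfold link; split_ifs <;> fun_prop

lemma contDiff_normFplus (v : Root N) :
    ContDiff ℂ ω (fun y : ℂ × (Root N → ℂ) => normFplus ν v y.1 y.2) :=
  contDiff_prod fun _ _ => (contDiff_bracket _ contDiff_fst (contDiff_xTilde _) contDiff_const).pow _

lemma contDiff_normFminus (v : Root N) :
    ContDiff ℂ ω (fun y : ℂ × (Root N → ℂ) => normFminus ν v y.1 y.2) :=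
  contDiff_prod fun _ _ => (contDiff_bracket _ contDiff_fst (contDiff_xTilde _) contDiff_const).pow _

lemma contDiff_normGplus (v : Root N) :
    ContDiff ℂ ω (fun y : ℂ × (Root N → ℂ) => normGplus ν v y.1 y.2) := by
  refine contDiff_prod fun w _ => ?_
  split_ifs
  · exact contDiff_const
  · exact contDiff_bracket _ contDiff_fst (contDiff_xTilde _) (contDiff_xTilde _)

lemma contDiff_normGminus (v : Root N) :
    ContDiff ℂ ω (fun y : ℂ × (Root N → ℂ) => normGminus ν v y.1 y.2) := by
  refine contDiff_prod fun w _ => ?_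
  split_ifs
  · exact contDiff_const
  · exact contDiff_bracket _ contDiff_fst (contDiff_xTilde _) (contDiff_xTilde _)

/-- The Bethe equation divided by the leading powers of `q`, as a map of the coordinates. -/
def residual (ν : X.Pattern) (y : ℂ × (Root N → ℂ)) (v : Root N) : ℂ :=
  normPlus ν v y.1 y.2 + normMinus ν v y.1 y.2

lemma contDiff_residual : ContDiff ℂ ω (residual (N := N) ν) := by
  refine contDiff_pi.2 fun v => ?_
  unfold residual normPlus normMinus
  exact .add (.mul (contDiff_normFplus v) (.mul (.mul contDiff_const (contDiff_link _ _))
    (contDiff_normGminus v))) (.mul (contDiff_normFminus v) (.mul (contDiff_link _ _)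
    (contDiff_normGplus v)))

lemma IsInitialPoint.residual_eq_zero (hN : OrderCondition ν N) {u : Root N → ℂ}
    (h : IsInitialPoint ν u) : residual ν (0, u) = 0 := by
  funext v
  simp only [residual, normPlus_zero hN, normMinus_zero hN]
  exact add_eq_zero_iff_eq_neg.2 (h.eq_zero v)

lemma IsInitialPoint.isInvertible (hN : OrderCondition ν N) (hA : (matA ν N).det ≠ 0)
    {u : Root N → ℂ} (h : IsInitialPoint ν u) :
    (fderiv ℂ (residual ν) ((0 : ℂ), u) ∘L .inr ℂ ℂ (Root N → ℂ)).IsInvertible := by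
  set f := fderiv ℂ (residual ν) ((0 : ℂ), u) ∘L .inr ℂ ℂ (Root N → ℂ) with hf
  have hinj : Function.Injective f := by
    refine (injective_iff_map_eq_zero _).2 fun w hw => ?_
    refine h.tangent_eq_zero hA fun v => ?_
    have hd : HasDerivAt (fun τ : ℂ => residual ν (0, fun v => u v + τ * w v)) 0 0 := by
      have h1 : HasDerivAt (fun τ : ℂ => ((0 : ℂ), fun v => u v + τ * w v)) ((0 : ℂ), w) 0 := by
        refine (hasDerivAt_const _ _).prodMk (hasDerivAt_pi.2 fun v => ?_)
        simpa using ((hasDerivAt_id (0 : ℂ)).mul_const (w v)).const_add (u v)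
      have h2 : HasFDerivAt (residual (N := N) ν) (fderiv ℂ (residual ν) ((0 : ℂ), u))
          ((0 : ℂ), fun v => u v + 0 * w v) := by
        simpa using ((contDiff_residual (ν := ν)).differentiable (by simp)
          ((0 : ℂ), u)).hasFDerivAt
      have := h2.comp_hasDerivAt (0 : ℂ) h1
      rw [hf] at hw
      simp only [ContinuousLinearMap.comp_apply, ContinuousLinearMap.inr_apply] at hw
      rw [hw] at this
      exact this
    have := (hasDerivAt_pi.1 hd v).deriv
    simp only [residual, normPlus_zero hN, normMinus_zero hN] at this
    exact this
  -- Unknowns and equations are both indexed by `Root N`, so injectivity suffices.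
  let e := LinearEquiv.ofInjectiveEndo (f : (Root N → ℂ) →ₗ[ℂ] (Root N → ℂ)) hinj
  exact ⟨e.toContinuousLinearEquiv, by ext; rfl⟩

lemma IsInitialPoint.exists_solution (hN : OrderCondition ν N) (hA : (matA ν N).det ≠ 0)
    {u₀ : Root N → ℂ} (h : IsInitialPoint ν u₀) :
    ∃ u : ℂ → Root N → ℂ, AnalyticAt ℂ u 0 ∧ u 0 = u₀ ∧ ∀ᶠ q in 𝓝 0, residual ν (q, u q) = 0 := by
  have hc : ContDiffAt ℂ ω (residual (N := N) ν) ((0 : ℂ), u₀) := contDiff_residual.contDiffAt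
  refine ⟨hc.implicitFunction (by simp) (h.isInvertible hN hA),
    (hc.contDiffAt_implicitFunction (by simp) (h.isInvertible hN hA)).analyticAt,
    hc.implicitFunction_apply_self (by simp) (h.isInvertible hN hA), ?_⟩
  filter_upwards [hc.eventually_apply_implicitFunction (by simp) (h.isInvertible hN hA)] with q hq
  rw [hq, h.residual_eq_zero hN]

/-- Local uniqueness in the implicit function theorem; continuity keeps both curves near the initial
point. -/
lemma IsInitialPoint.eventuallyEq (hN : OrderCondition ν N) (hA : (matA ν N).det ≠ 0)
    {u₀ : Root N → ℂ} (h : IsInitialPoint ν u₀) {u u' : ℂ → Root N → ℂ}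
    (hu : ContinuousAt u 0) (hu' : ContinuousAt u' 0) (hu0 : u 0 = u₀) (hu0' : u' 0 = u₀)
    (hr : ∀ᶠ q in 𝓝 0, residual ν (q, u q) = 0) (hr' : ∀ᶠ q in 𝓝 0, residual ν (q, u' q) = 0) :
    u =ᶠ[𝓝 0] u' := by
  have hc : ContDiffAt ℂ ω (residual (N := N) ν) ((0 : ℂ), u₀) := contDiff_residual.contDiffAt
  have key : ∀ u : ℂ → Root N → ℂ, ContinuousAt u 0 → u 0 = u₀ →
      (∀ᶠ q in 𝓝 0, residual ν (q, u q) = 0) →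
      ∀ᶠ q in 𝓝 0, hc.implicitFunction (by simp) (h.isInvertible hN hA) q = u q := by
    intro u hu hu0 hr
    have ht : Tendsto (fun q : ℂ => (q, u q)) (𝓝 0) (𝓝 ((0 : ℂ), u₀)) := by
      rw [← hu0]; exact (continuousAt_id.prodMk hu).tendsto
    filter_upwards [ht.eventually (hc.eventually_apply_eq_iff_implicitFunction (by simp)
      (h.isInvertible hN hA)), hr] with q hq hrq
    exact hq.1 (by rw [hrq, h.residual_eq_zero hN])
  filter_upwards [key u hu hu0 hr, key u' hu' hu0' hr'] with q h1 h2
  rw [← h1, h2]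

/-! ### From coordinates to generic string solutions -/

lemma meromorphicAt_of_eq_zpow_mul {f h : ℂ → ℂ} {n : ℤ} (hh : AnalyticAt ℂ h 0)
    (hf : ∀ᶠ q in 𝓝[≠] 0, f q = q ^ n * h q) : MeromorphicAt f 0 := by
  refine MeromorphicAt.congr (f := fun q => q ^ n * h q) ?_ (hf.mono fun q hq => hq.symm)
  exact ((MeromorphicAt.id 0).zpow n).mul hh.meromorphicAt

/-- Translates each order requirement on `F` and `G` into a nonvanishing condition at `q = 0`, in
both directions. -/
lemma meromorphicOrderAt_eq_iff_ne_zero {f h : ℂ → ℂ} {n : ℤ} (hh : AnalyticAt ℂ h 0)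
    (hf : ∀ᶠ q in 𝓝[≠] 0, f q = q ^ n * h q) :
    meromorphicOrderAt f 0 = (n : WithTop ℤ) ↔ h 0 ≠ 0 := by
  rw [meromorphicOrderAt_eq_int_iff (meromorphicAt_of_eq_zpow_mul hh hf)]
  constructor
  · rintro ⟨g, hg, hg0, hfg⟩
    have heq : h =ᶠ[𝓝[≠] 0] g := by
      filter_upwards [hf, hfg, self_mem_nhdsWithin] with q h1 h2 hq
      rw [h1, sub_zero, smul_eq_mul] at h2
      exact mul_left_cancel₀ (zpow_ne_zero n hq) h2
    have := (hh.continuousAt.eventuallyEq_nhds_iff_eventuallyEq_nhdsNE hg.continuousAt).1 heq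
    rwa [this.eq_of_nhds]
  · exact fun h0 => ⟨h, hh, h0, by simpa using hf⟩

/-- `u` are analytic coordinates of the family `x`. -/
structure IsCoordinates (ν : X.Pattern) (x : Root N → ℂ → ℂ) (u : ℂ → Root N → ℂ) : Prop where
  analytic : AnalyticAt ℂ u 0
  eventually_eq : ∀ᶠ q in 𝓝[≠] 0, ∀ v, x v q = q ^ v.d * xTilde ν q (u q) v

namespace IsCoordinates

variable {x : Root N → ℂ → ℂ} {u : ℂ → Root N → ℂ}

lemma analyticAt_comp (h : IsCoordinates ν x u) {f : ℂ × (Root N → ℂ) → ℂ} (hf : ContDiff ℂ ω f) :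
    AnalyticAt ℂ (fun q => f (q, u q)) 0 :=
  AnalyticAt.fun_comp (g := f) (f := fun q => (q, u q)) hf.contDiffAt.analyticAt
    (analyticAt_id.prod h.analytic)

lemma eventually_eq_of_ne (h : IsCoordinates ν x u) {p : ℂ → Prop}
    (hp : ∀ q, q ≠ 0 → (∀ v, x v q = q ^ v.d * xTilde ν q (u q) v) → p q) :
    ∀ᶠ q in 𝓝[≠] 0, p q := by
  filter_upwards [h.eventually_eq, self_mem_nhdsWithin] with q h1 hq
  exact hp q hq h1

lemma meromorphicAt (h : IsCoordinates ν x u) (v : Root N) : MeromorphicAt (x v) 0 :=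
  meromorphicAt_of_eq_zpow_mul (h.analyticAt_comp (contDiff_xTilde (ν := ν) v))
    (h.eventually_eq.mono fun _ hq => hq v)

lemma order_eq (hN : OrderCondition ν N) (h : IsCoordinates ν x u) (h0 : ∀ v, u 0 v ≠ 0)
    (v : Root N) : meromorphicOrderAt (x v) 0 = (v.d : WithTop ℤ) := by
  rw [meromorphicOrderAt_eq_iff_ne_zero (h.analyticAt_comp (contDiff_xTilde (ν := ν) v))
    (h.eventually_eq.mono fun _ hq => hq v), xTilde_zero hN]
  exact h0 _

lemma trailingCoeff_eq (hN : OrderCondition ν N) (h : IsCoordinates ν x u) (h0 : ∀ v, u 0 v ≠ 0)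
    (v : Root N) : meromorphicTrailingCoeffAt (x v) 0 = centers (u 0) v.1 := by
  have hx : xTilde ν 0 (u 0) v = centers (u 0) v.1 := xTilde_zero hN _ _
  rw [← hx]
  refine AnalyticAt.meromorphicTrailingCoeffAt_of_ne_zero_of_eq_nhdsNE (n := v.d)
    (h.analyticAt_comp (contDiff_xTilde (ν := ν) v)) ?_ ?_
  · rw [hx]; exact h0 _
  · filter_upwards [h.eventually_eq] with q hq
    simpa using hq v

lemma order_Fplus_iff (h : IsCoordinates ν x u) (v : Root N) :
    meromorphicOrderAt (Fplus ν Root.color x v) 0 = (xiPlus ν v : WithTop ℤ) ↔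
      normFplus ν v 0 (u 0) ≠ 0 :=
  meromorphicOrderAt_eq_iff_ne_zero (h.analyticAt_comp (contDiff_normFplus v))
    (h.eventually_eq_of_ne fun _ hq hx => Fplus_eq hq v (hx v))

lemma order_Fminus_iff (h : IsCoordinates ν x u) (v : Root N) :
    meromorphicOrderAt (Fminus ν Root.color x v) 0 = (xiMinus ν v : WithTop ℤ) ↔
      normFminus ν v 0 (u 0) ≠ 0 :=
  meromorphicOrderAt_eq_iff_ne_zero (h.analyticAt_comp (contDiff_normFminus v))
    (h.eventually_eq_of_ne fun _ hq hx => Fminus_eq hq v (hx v))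

lemma order_Gplus_iff (hN : OrderCondition ν N) (h : IsCoordinates ν x u) (v : Root N) :
    meromorphicOrderAt (Gplus Root.color x v) 0 =
      ((etaPlus v + zetaOrd ν v.1 v.2 : ℤ) : WithTop ℤ) ↔
      link (u 0) v.1 v.2 * normGplus ν v 0 (u 0) ≠ 0 :=
  meromorphicOrderAt_eq_iff_ne_zero
    (h.analyticAt_comp ((contDiff_link v.1 v.2).mul (contDiff_normGplus (ν := ν) v)))
    (h.eventually_eq_of_ne fun _ hq hx => Gplus_eq hN hq hx v)

lemma order_Gminus_iff (hN : OrderCondition ν N) (h : IsCoordinates ν x u) (v : Root N) :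
    meromorphicOrderAt (Gminus Root.color x v) 0 =
      ((etaMinus v + zetaOrd ν v.1 ((v.2 : ℕ) + 1) : ℤ) : WithTop ℤ) ↔
      nextSign v * link (u 0) v.1 ((v.2 : ℕ) + 1) * normGminus ν v 0 (u 0) ≠ 0 :=
  meromorphicOrderAt_eq_iff_ne_zero
    (h.analyticAt_comp ((contDiff_const.mul (contDiff_link v.1 _)).mul
      (contDiff_normGminus (ν := ν) v)))
    (h.eventually_eq_of_ne fun _ hq hx => Gminus_eq hN hq hx v)

/-- The two sides of the Bethe equation carry the same power of `q`. -/
lemma bethe_iff (hN : OrderCondition ν N) {q : ℂ} (hq : q ≠ 0) {u : Root N → ℂ}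
    (hx : ∀ v, x v q = q ^ v.d * xTilde ν q u v) (v : Root N) :
    Fplus ν Root.color x v q * Gminus Root.color x v q =
      -(Fminus ν Root.color x v q * Gplus Root.color x v q) ↔ residual ν (q, u) v = 0 := by
  have h1 : Fplus ν Root.color x v q * Gminus Root.color x v q =
      q ^ (xiPlus ν v + (etaMinus v + zetaOrd ν v.1 ((v.2 : ℕ) + 1))) * normPlus ν v q u := by
    rw [Fplus_eq hq v (hx v), Gminus_eq hN hq hx, zpow_add₀ hq (xiPlus ν v), normPlus]
    ring
  have h2 : Fminus ν Root.color x v q * Gplus Root.color x v q =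
      q ^ (xiPlus ν v + (etaMinus v + zetaOrd ν v.1 ((v.2 : ℕ) + 1))) * normMinus ν v q u := by
    have : xiPlus ν v + (etaMinus v + zetaOrd ν v.1 ((v.2 : ℕ) + 1)) =
        xiMinus ν v + (etaPlus v + zetaOrd ν v.1 v.2) := by
      rw [zetaOrd_succ]; ring
    rw [Fminus_eq hq v (hx v), Gplus_eq hN hq hx, this, zpow_add₀ hq (xiMinus ν v), normMinus]
    ring
  rw [h1, h2, ← mul_neg, mul_right_inj' (zpow_ne_zero _ hq), residual, add_eq_zero_iff_eq_neg]

lemma zeta_eq (hN : OrderCondition ν N) (h : IsCoordinates ν x u) (h0 : ∀ v, u 0 v ≠ 0)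
    (s : Str N) {i : ℕ} (hi : i ≤ s.len) : zeta x s (i + 1) = (zetaOrd ν s i : WithTop ℤ) := by
  unfold zeta
  split_ifs with h2
  · have hn : IsNext (⟨s, ⟨i - 1, by omega⟩⟩ : Root N) ⟨s, ⟨i, by omega⟩⟩ :=
      ⟨rfl, by simp only; omega⟩
    refine (meromorphicOrderAt_eq_iff_ne_zero (h := fun q => u q ⟨s, ⟨i, by omega⟩⟩)
      (analyticAt_pi_iff.1 h.analytic _) ?_).2 (h0 _)
    refine h.eventually_eq_of_ne fun q hq hx => ?_
    have key : ∀ v, normalized x v q = xTilde ν q (u q) v := fun v => by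
      rw [normalized, hx v, ← mul_assoc, ← zpow_add₀ hq, neg_add_cancel, zpow_zero, one_mul]
    rw [key, key]
    have h3 := xTilde_sub ν q (u q) hn
    rw [zpow_zetaOrd_toNat hN] at h3
    exact h3
  -- Outside the inner range both sides are 0: `zeta` by convention and `zetaOrd` by `zetaOrd_zero`
  -- and `zetaOrd_len`.
  · have : i = 0 ∨ i = s.len := by omega
    rcases this with rfl | rfl <;> simp

lemma isGenericStringSolution (hN : OrderCondition ν N) (h : IsCoordinates ν x u)
    (h0 : IsInitialPoint ν (u 0)) (hr : ∀ᶠ q in 𝓝 0, residual ν (q, u q) = 0) :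
    IsGenericStringSolution ν N x := by
  have hP : ∀ v, normPlus ν v 0 (u 0) ≠ 0 := fun v => by
    rw [normPlus_zero hN]
    exact mul_ne_zero (h0.coef_ne_zero v).1 (link_ne_zero h0.ne_zero _ _)
  have hM : ∀ v, normMinus ν v 0 (u 0) ≠ 0 := fun v => by
    rw [normMinus_zero hN]
    exact mul_ne_zero (h0.coef_ne_zero v).2 (link_ne_zero h0.ne_zero _ _)
  have hFp : ∀ v, meromorphicOrderAt (Fplus ν Root.color x v) 0 = (xiPlus ν v : WithTop ℤ) :=
    fun v => (h.order_Fplus_iff v).2 (left_ne_zero_of_mul (hP v))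
  have hFm : ∀ v, meromorphicOrderAt (Fminus ν Root.color x v) 0 = (xiMinus ν v : WithTop ℤ) :=
    fun v => (h.order_Fminus_iff v).2 (left_ne_zero_of_mul (hM v))
  have hGp : ∀ v : Root N, meromorphicOrderAt (Gplus Root.color x v) 0 =
      ((etaPlus v + zetaOrd ν v.1 v.2 : ℤ) : WithTop ℤ) :=
    fun v => (h.order_Gplus_iff hN v).2 (right_ne_zero_of_mul (hM v))
  have hGm : ∀ v : Root N, meromorphicOrderAt (Gminus Root.color x v) 0 =
      ((etaMinus v + zetaOrd ν v.1 ((v.2 : ℕ) + 1) : ℤ) : WithTop ℤ) :=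
    fun v => (h.order_Gminus_iff hN v).2 (right_ne_zero_of_mul (hP v))
  have hb : ∀ v, ∀ᶠ q in 𝓝[≠] (0 : ℂ), Fplus ν Root.color x v q * Gminus Root.color x v q =
      -(Fminus ν Root.color x v q * Gplus Root.color x v q) := by
    intro v
    filter_upwards [h.eventually_eq, self_mem_nhdsWithin, hr.filter_mono nhdsWithin_le_nhds]
      with q hx hq hrq
    rw [bethe_iff hN hq hx, hrq]
    rfl
  have hadm : IsAdmissible ν Root.color x := by
    intro v
    have hne : meromorphicOrderAt (fun q => Fplus ν Root.color x v q * Gminus Root.color x v q) 0 =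
        ((xiPlus ν v + (etaMinus v + zetaOrd ν v.1 ((v.2 : ℕ) + 1)) : ℤ) : WithTop ℤ) := by
      refine (meromorphicOrderAt_eq_iff_ne_zero (h := fun q => normPlus ν v q (u q)) ?_ ?_).2 (hP v)
      · unfold normPlus
        exact h.analyticAt_comp ((contDiff_normFplus (ν := ν) v).mul
          ((contDiff_const.mul (contDiff_link v.1 _)).mul (contDiff_normGminus (ν := ν) v)))
      · refine h.eventually_eq_of_ne fun q hq hx => ?_
        rw [Fplus_eq hq v (hx v), Gminus_eq hN hq hx, zpow_add₀ hq (xiPlus ν v), normPlus]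
        ring
    rw [hne]
    exact WithTop.coe_lt_top _
  exact
    { solution := ⟨h.meromorphicAt, hb⟩
      admissible := hadm
      order := h.order_eq hN h0.ne_zero
      leading := fun s i j => by
        rw [h.trailingCoeff_eq hN h0.ne_zero, h.trailingCoeff_eq hN h0.ne_zero]
      ord_Fplus := hFp
      ord_Fminus := hFm
      ord_Gplus := fun v => by
        rw [hGp, h.zeta_eq hN h0.ne_zero v.1 v.2.isLt.le, WithTop.coe_add]
      ord_Gminus := fun v => by
        rw [hGm, h.zeta_eq hN h0.ne_zero v.1 v.2.isLt, WithTop.coe_add] }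

end IsCoordinates

/-! ### From generic string solutions to coordinates -/

lemma meromorphicAt_Fplus {x : Root N → ℂ → ℂ} (hx : ∀ v, MeromorphicAt (x v) 0)
    (v : Root N) : MeromorphicAt (Fplus ν Root.color x v) 0 := by
  have := hx v
  unfold Fplus
  exact MeromorphicAt.fun_prod fun p _ => by fun_prop

lemma meromorphicAt_Fminus {x : Root N → ℂ → ℂ} (hx : ∀ v, MeromorphicAt (x v) 0)
    (v : Root N) : MeromorphicAt (Fminus ν Root.color x v) 0 := by
  have := hx v
  unfold Fminus
  exact MeromorphicAt.fun_prod fun p _ => by fun_prop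

lemma meromorphicAt_Gplus {x : Root N → ℂ → ℂ} (hx : ∀ v, MeromorphicAt (x v) 0)
    (v : Root N) : MeromorphicAt (Gplus Root.color x v) 0 := by
  have := hx v
  unfold Gplus
  exact MeromorphicAt.fun_prod fun w _ => by have := hx w; fun_prop

lemma meromorphicAt_Gminus {x : Root N → ℂ → ℂ} (hx : ∀ v, MeromorphicAt (x v) 0)
    (v : Root N) : MeromorphicAt (Gminus Root.color x v) 0 := by
  have := hx v
  unfold Gminus
  exact MeromorphicAt.fun_prod fun w _ => by have := hx w; fun_prop

namespace IsGenericStringSolution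

variable {x : Root N → ℂ → ℂ}

/-- Equality of orders in the Bethe equation is a recursion for ζ along the string, the same one
that `zetaOrd` satisfies. -/
lemma zeta_eq (h : IsGenericStringSolution ν N x) (s : Str N) {i : ℕ} (hi : i ≤ s.len) :
    zeta x s (i + 1) = (zetaOrd ν s i : WithTop ℤ) := by
  induction i with
  | zero => simp [zeta]
  | succ i ih =>
    let v : Root N := ⟨s, ⟨i, hi⟩⟩
    have hx := h.solution.1
    have h1 : meromorphicOrderAt (Fplus ν Root.color x v * Gminus Root.color x v) 0 =
        meromorphicOrderAt (Fminus ν Root.color x v * Gplus Root.color x v) 0 := by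
      rw [meromorphicOrderAt_neg (f := Fminus ν Root.color x v * Gplus Root.color x v)]
      exact meromorphicOrderAt_congr (h.solution.2 v)
    rw [meromorphicOrderAt_mul (meromorphicAt_Fplus hx v) (meromorphicAt_Gminus hx v),
      meromorphicOrderAt_mul (meromorphicAt_Fminus hx v) (meromorphicAt_Gplus hx v),
      h.ord_Fplus, h.ord_Gminus, h.ord_Fminus, h.ord_Gplus] at h1
    change _ + (_ + zeta x s (i + 2)) = _ + (_ + zeta x s (i + 1)) at h1
    rw [ih (by omega)] at h1
    have h2 := zetaOrd_succ ν v
    change zetaOrd ν s (i + 1) = zetaOrd ν s i + _ at h2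
    rw [show i + 1 + 1 = i + 2 from rfl]
    cases hz : zeta x s (i + 2) with
    -- The other side has finite order by induction, so consecutive members cannot coincide
    -- identically.
    | top => rw [hz] at h1; simp [← WithTop.coe_add] at h1
    | coe a =>
      rw [hz] at h1
      norm_cast at h1 ⊢
      omega

/-- Knowing the exact orders of the first members and of the consecutive differences, one divides by
these powers of `q`; the quotients are analytic and nonzero at 0. -/
lemma exists_isCoordinates (hN : OrderCondition ν N) (h : IsGenericStringSolution ν N x) :
    ∃ u : ℂ → Root N → ℂ, IsCoordinates ν x u ∧ IsInitialPoint ν (u 0) ∧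
      ∀ᶠ q in 𝓝 0, residual ν (q, u q) = 0 := by
  have hfirst : ∀ s : Str N, ∃ g : ℂ → ℂ, AnalyticAt ℂ g 0 ∧ g 0 ≠ 0 ∧
      ∀ᶠ q in 𝓝[≠] 0, normalized x s.first q = g q := by
    intro s
    obtain ⟨g, hg, hg0, hxg⟩ :=
      (meromorphicOrderAt_eq_int_iff (h.solution.1 s.first)).1 (h.order s.first)
    refine ⟨g, hg, hg0, ?_⟩
    filter_upwards [hxg, self_mem_nhdsWithin] with q hq hq0
    rw [normalized, hq, sub_zero, smul_eq_mul, ← mul_assoc, ← zpow_add₀ hq0, neg_add_cancel,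
      zpow_zero, one_mul]
  have hnext : ∀ v w : Root N, IsNext v w → ∃ g : ℂ → ℂ, AnalyticAt ℂ g 0 ∧ g 0 ≠ 0 ∧
      ∀ᶠ q in 𝓝[≠] 0, normalized x w q - normalized x v q =
        q ^ (zetaOrd ν w.1 w.2).toNat * g q := by
    rintro ⟨s, i, hi⟩ ⟨s', j, hj⟩ ⟨h1, h2⟩
    obtain rfl : s = s' := h1
    obtain rfl : j = i + 1 := h2
    have hz := h.zeta_eq s (i := i + 1) hj.le
    rw [zeta, dif_pos ⟨by omega, hj⟩, meromorphicOrderAt_eq_int_iff] at hz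
    · obtain ⟨g, hg, hg0, hxg⟩ := hz
      refine ⟨g, hg, hg0, ?_⟩
      filter_upwards [hxg] with q hq
      simp only [zpow_zetaOrd_toNat hN (⟨s, ⟨i + 1, hj⟩⟩ : Root N)]
      rw [sub_zero, smul_eq_mul] at hq
      exact hq
    · have h1 := h.solution.1 ⟨s, ⟨i + 1 + 1 - 1, by omega⟩⟩
      have h2 := h.solution.1 ⟨s, ⟨i + 1 + 1 - 2, by omega⟩⟩
      unfold normalized
      exact (((MeromorphicAt.id 0).zpow _).mul h1).sub (((MeromorphicAt.id 0).zpow _).mul h2)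
  -- First members and differences are merged into one statement, so that a single function can be
  -- chosen for each root.
  have hall : ∀ w : Root N, ∃ g : ℂ → ℂ, AnalyticAt ℂ g 0 ∧ g 0 ≠ 0 ∧
      ((w.2 : ℕ) = 0 → ∀ᶠ q in 𝓝[≠] 0, normalized x w q = g q) ∧
      ∀ v, IsNext v w → ∀ᶠ q in 𝓝[≠] 0, normalized x w q - normalized x v q =
        q ^ (zetaOrd ν w.1 w.2).toNat * g q := by
    intro w
    have hw := w.2.isLt
    rcases Nat.eq_zero_or_pos (w.2 : ℕ) with hw0 | hw0
    · obtain ⟨g, hg, hg0, hxg⟩ := hfirst w.1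
      have : w = w.1.first := Root.ext' rfl hw0
      refine ⟨g, hg, hg0, fun _ => by rwa [this], fun v hv => ?_⟩
      have := hv.2
      omega
    · let v : Root N := ⟨w.1, ⟨(w.2 : ℕ) - 1, by omega⟩⟩
      have hvw : IsNext v w := ⟨rfl, by simp only [v]; omega⟩
      obtain ⟨g, hg, hg0, hxg⟩ := hnext v w hvw
      refine ⟨g, hg, hg0, fun h0 => absurd h0 hw0.ne', fun v' hv' => ?_⟩
      have h2 := hv'.2
      have : v' = v := Root.ext' hv'.1 (by simp only [v]; omega)
      rwa [this]
  choose g hg hg0 hgfirst hgnext using hall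
  have hx : ∀ (s : Str N) (i : ℕ) (hi : i < s.len), ∀ᶠ q in 𝓝[≠] 0,
      normalized x ⟨s, ⟨i, hi⟩⟩ q = xTilde ν q (fun v => g v q) ⟨s, ⟨i, hi⟩⟩ := by
    intro s i
    induction i with
    | zero =>
      intro hi
      filter_upwards [hgfirst s.first rfl] with q hq
      exact hq.trans (xTilde_first ν q (fun v => g v q) s).symm
    | succ i ih =>
      intro hi
      have hn : IsNext (⟨s, ⟨i, by omega⟩⟩ : Root N) ⟨s, ⟨i + 1, hi⟩⟩ := ⟨rfl, rfl⟩
      filter_upwards [ih (by omega), hgnext _ _ hn] with q h1 h2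
      rw [← xTilde_sub ν q (fun v => g v q) hn, h1] at h2
      exact sub_left_injective h2
  have hu : IsCoordinates ν x (fun q v => g v q) := by
    refine ⟨analyticAt_pi_iff.2 hg, ?_⟩
    filter_upwards [eventually_all.2 fun v : Root N => hx v.1 v.2 v.2.isLt, self_mem_nhdsWithin]
      with q hq hq0 v
    rw [← hq v, normalized, ← mul_assoc, ← zpow_add₀ hq0, add_neg_cancel, zpow_zero, one_mul]
  -- The Bethe equation holds only for `q ≠ 0`; continuity extends the normalized system to `q = 0`,
  -- which yields the equations of the initial point.
  have hr : ∀ᶠ q in 𝓝 (0 : ℂ), residual ν (q, fun v => g v q) = 0 := by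
    have hne : (fun q => residual ν (q, fun v => g v q)) =ᶠ[𝓝[≠] 0] fun _ => 0 := by
      filter_upwards [hu.eventually_eq, self_mem_nhdsWithin, eventually_all.2 h.solution.2]
        with q hxq hq0 hb
      funext v
      exact (IsCoordinates.bethe_iff hN hq0 hxq v).1 (hb v)
    refine (ContinuousAt.eventuallyEq_nhds_iff_eventuallyEq_nhdsNE ?_ continuousAt_const).1 hne
    exact (contDiff_residual (ν := ν)).continuous.continuousAt.comp
      (continuousAt_id.prodMk hu.analytic.continuousAt)
  refine ⟨_, hu, ⟨hg0, fun v => ⟨?_, ?_⟩, fun v => ?_⟩, hr⟩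
  · have h1 := (hu.order_Fplus_iff v).1 (h.ord_Fplus v)
    have h2 := (hu.order_Gminus_iff hN v).1 (by
      rw [h.ord_Gminus, h.zeta_eq v.1 v.2.isLt, WithTop.coe_add])
    have h3 := mul_ne_zero h1 h2
    change normPlus ν v 0 _ ≠ 0 at h3
    rw [normPlus_zero hN] at h3
    exact left_ne_zero_of_mul h3
  · have h1 := (hu.order_Fminus_iff v).1 (h.ord_Fminus v)
    have h2 := (hu.order_Gplus_iff hN v).1 (by
      rw [h.ord_Gplus, h.zeta_eq v.1 v.2.isLt.le, WithTop.coe_add])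
    have h3 := mul_ne_zero h1 h2
    change normMinus ν v 0 _ ≠ 0 at h3
    rw [normMinus_zero hN] at h3
    exact left_ne_zero_of_mul h3
  · have h1 := congrFun hr.self_of_nhds v
    simp only [residual, normPlus_zero hN, normMinus_zero hN] at h1
    exact add_eq_zero_iff_eq_neg.1 h1

end IsGenericStringSolution

lemma stringCenters_eq (hN : OrderCondition ν N) {g : Root N → QGerm} {x : Root N → ℂ → ℂ}
    (hg : ∀ v, g v = (x v : QGerm)) {u : ℂ → Root N → ℂ} (hu : IsCoordinates ν x u)
    (h0 : ∀ v, u 0 v ≠ 0) : stringCenters N g = centers (u 0) := by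
  funext s
  rw [stringCenters, hg]
  exact hu.trailingCoeff_eq hN h0 s.first

end StringBethe

end

/-! ### The bijection -/

theorem theorem2p7 (X : StringBethe.CartanType) (ν N : X.Pattern)
    (hN : StringBethe.OrderCondition ν N) (hA : (StringBethe.matA ν N).det ≠ 0) :
    Set.BijOn (StringBethe.stringCenters N) (StringBethe.genericStringSolutions ν N)
      (StringBethe.genericSCESolutions ν N) := by
  refine ⟨?_, ?_, ?_⟩
  · rintro g ⟨x, hx, hg⟩
    obtain ⟨u, hu, h0, -⟩ := hx.exists_isCoordinates hN
    rw [StringBethe.stringCenters_eq hN hg hu h0.ne_zero]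
    exact h0.isGenericSCESolution
  · rintro g ⟨x, hx, hg⟩ g' ⟨x', hx', hg'⟩ hgg
    obtain ⟨u, hu, h0, hr⟩ := hx.exists_isCoordinates hN
    obtain ⟨u', hu', h0', hr'⟩ := hx'.exists_isCoordinates hN
    rw [StringBethe.stringCenters_eq hN hg hu h0.ne_zero,
      StringBethe.stringCenters_eq hN hg' hu' h0'.ne_zero] at hgg
    -- Equal centers give equal initial points, and these determine the germ of the coordinates.
    have hev := h0.eventuallyEq hN hA hu.analytic.continuousAt hu'.analytic.continuousAt rfl
      (h0.eq_of_centers_eq h0' hgg).symm hr hr'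
    funext v
    rw [hg, hg']
    refine Filter.Germ.coe_eq.2 ?_
    filter_upwards [hu.eventually_eq, hu'.eventually_eq, hev.filter_mono nhdsWithin_le_nhds]
      with q h1 h2 h3
    rw [h1, h2, h3]
  · intro z hz
    obtain ⟨u₀, h0, hc⟩ := StringBethe.IsGenericSCESolution.exists_isInitialPoint hz
    obtain ⟨u, hu, rfl, hr⟩ := h0.exists_solution hN hA
    let x : StringBethe.Root N → ℂ → ℂ := fun v q =>
      q ^ v.d * StringBethe.xTilde ν q (u q) v
    have hux : StringBethe.IsCoordinates ν x u := ⟨hu, Filter.Eventually.of_forall fun _ _ => rfl⟩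
    refine ⟨fun v => (x v : StringBethe.QGerm), ⟨x, hux.isGenericStringSolution hN h0 hr,
      fun _ => rfl⟩, ?_⟩
    rw [StringBethe.stringCenters_eq hN (fun _ => rfl) hux h0.ne_zero, hc]
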